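/- **Conventions.** Let $n\ge 2$ and let $\mathbb{R}^{1,n+1}$ be $\mathbb{R}^{n+2}$ with $\langle X,Y\rangle=-x_0y_0+\sum_{i=1}^{n+1}x_iy_i$. Put $\mathbb{H}^{n+1}=\{X:\langle X,X\rangle=-1,\ x_0>0\}$, with ideal boundary $\mathbb{S}^n$, a point $x\in\mathbb{S}^n\subset\mathbb{R}^{n+1}$ being identified with the null direction $(1,x)$. Everything is smooth. An oriented immersed hypersurface is an immersion $\phi:M^n\to\mathbb{H}^{n+1}$ with a unit normal field $\eta$ ($\langle\eta,\eta\rangle=1$, $\langle\eta,\phi\rangle=0$, $\langle\eta,d\phi\rangle=0$). Its principal curvatures are the eigenvalues of the operator $A$ with $d\eta=-d\phi\circ A$. It is *complete* if the induced metric is complete, *properly immersed* if $\phi$ is a proper map into $\mathbb{H}^{n+1}$, and *uniformly weakly horospherically convex* if for some constant $\kappa_0>-1$ all principal curvatures at all points are $\ge\kappa_0$. Its *hyperbolic Gauss map* $G:M\to\mathbb{S}^n$ and *horospherical support function* $\tilde\rho:M\to\mathbb{R}$ are given by $\psi:=\phi-\eta=e^{\tilde\rho}(1,G)$ (so $G(p)$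 is the point at infinity of the unique horosphere through $\phi(p)$ whose outward unit normal at $\phi(p)$ is $\eta(p)$), and its *horospherical metric* is $\psi^*\langle\cdot,\cdot\rangle$. Its boundary at infinity $\partial_\infty\phi(M)\subset\mathbb{S}^n$ is the set of points of the ideal sphere that are limits of points of $\phi(M)$ in the closed Poincaré ball. Let $g=g_{\mathbb{S}^n}$ be the round metric, and $\nabla$ its Levi-Civita connection. For a smooth function $\rho$ on an open set $\Omega\subset\mathbb{S}^n$, let $$P=-\nabla^2\rho+d\rho\otimes d\rho-\tfrac12\bigl(|\nabla\rho|_g^2-1\bigr)g ;$$ $P$ is *bounded* if $|P|_{\hat g}$ is bounded on $\Omega$, where $\hat g=e^{2\rho}g$. Boundaries $\partial\Omega$ are taken in $\mathbb{S}^n$. **Theorem.** Let $n\ge 2$. (1) Let $\phi:M^n\to\mathbb{H}^{n+1}$ be an immersed, oriented, complete, uniformly weakly horospherically convex hypersurface with injective hyperbolic Gauss map $G$. Then $\Omega=G(M)$ is open in $\mathbb{S}^n$ (and connected if $M$ is connected), and there is a smooth function $\rho$ on $\Omega$ with $\rho\circ G=\tilde\rho$ such that $\hat g=e^{2\rho}g$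 is a complete conformal metric on $\Omega$ with bounded $P$ and $G^*\hat g$ is the horospherical metric of $\phi$; moreover $$\partial_\infty\phi(M)=\partial G(M).$$ (2) Conversely, let $\hat g=e^{2\rho}g$ be a complete conformal metric on an open set $\Omega\subset\mathbb{S}^n$ (for instance a domain) with bounded $P$. Then there is $t_0\in\mathbb{R}$ such that for every $t\ge t_0$ the map $$\phi^t(x)=\frac{e^{\rho+t}}{2}\Bigl(1+e^{-2(\rho+t)}\bigl(1+|\nabla\rho|_g^2\bigr)\Bigr)(1,x)+e^{-(\rho+t)}(0,-x+\nabla\rho),\qquad x\in\Omega,$$ with a suitable unit normal field, is a properly immersed, complete, uniformly weakly horospherically convex hypersurface $\Omega\to\mathbb{H}^{n+1}$ whose hyperbolic Gauss map is the identity $x\mapsto x$ (in particular injective) and whose horospherical support function is $\rho+t$; moreover $$\partial_\infty\phi^t(\Omega)=\partial\Omega .$$ -/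

import Mathlib

open Set Filter Topology
open scoped Manifold ContDiff ENNReal RealInnerProductSpace

noncomputable section

namespace HoroConvex

/-! ### Minkowski space, hyperbolic space and the round sphere -/

/-- The Euclidean space containing the unit sphere of dimension `n`. -/
abbrev Euc (n : ℕ) : Type := EuclideanSpace ℝ (Fin (n + 1))

/-- The round sphere, with Mathlib's topology and smooth structure. It is identified with the
ideal boundary of hyperbolic space through `x ↦ (1, x)`. -/
abbrev Sph (n : ℕ) : Type := Metric.sphere (0 : Euc n) 1

/-- The vector space underlying Minkowski space; the first component is the time coordinate. -/
abbrev Mink (n : ℕ) : Type := ℝ × Euc n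

/-- The Minkowski form `-x₀ y₀ + x₁ y₁ + ... + xₙ₊₁ yₙ₊₁`. -/
def mink {n : ℕ} (X Y : Mink n) : ℝ := -(X.1 * Y.1) + ⟪X.2, Y.2⟫

/-- Hyperbolic space of dimension `n + 1` (hyperboloid model). -/
def Hyp (n : ℕ) : Set (Mink n) := {X | mink X X = -1 ∧ 0 < X.1}

/-- The null vector `(1, x)` representing the ideal point `x`. -/
def nullVec {n : ℕ} (x : Sph n) : Mink n := (1, (x : Euc n))

/-- The horosphere with point at infinity `x` and signed distance parameter `s`; the horoball which
it bounds is `{X ∈ Hyp n | -exp (-s) < mink X (nullVec x)}`. -/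
def horosphere {n : ℕ} (x : Sph n) (s : ℝ) : Set (Mink n) :=
  {X | X ∈ Hyp n ∧ mink X (nullVec x) = -Real.exp (-s)}

/-- The outward unit normal of `horosphere x s` at its point `X` (it points away from the ideal
point `x`). -/
def horosphereNormal {n : ℕ} (x : Sph n) (s : ℝ) (X : Mink n) : Mink n :=
  X - Real.exp s • nullVec x

/-! ### Completeness of a Riemannian metric -/

/-- `nrm p v` is the length of the tangent vector `v` at `p` for a Riemannian metric on the
manifold `M`. The metric is complete if every sequence which is Cauchy for the Riemannian distance
(infimum of lengths of `C¹` paths) converges in `M`. -/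
def IsCompleteNorm {n : ℕ} {M : Type*} [TopologicalSpace M]
    [ChartedSpace (EuclideanSpace ℝ (Fin n)) M]
    (nrm : ∀ p : M, TangentSpace (𝓡 n) p → ℝ) : Prop :=
  letI : ∀ p : M, ENorm (TangentSpace (𝓡 n) p) := fun p => ⟨fun v => ENNReal.ofReal (nrm p v)⟩
  ∀ u : ℕ → M,
    (∀ ε : ℝ≥0∞, 0 < ε → ∃ N, ∀ i ≥ N, ∀ j ≥ N,
      Manifold.riemannianEDist (𝓡 n) (u i) (u j) < ε) →
    ∃ p, Tendsto u atTop (𝓝 p)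

/-! ### Oriented immersed hypersurfaces of hyperbolic space -/

/-- An oriented immersed hypersurface of hyperbolic space: a smooth immersion `φ` with a smooth
field `η` of unit vectors which are tangent to hyperbolic space and normal to the hypersurface. -/
structure OrientedHypersurface (n : ℕ) (M : Type*) [TopologicalSpace M]
    [ChartedSpace (EuclideanSpace ℝ (Fin n)) M] where
  /-- the immersion -/
  φ : M → Mink n
  /-- the unit normal field -/
  η : M → Mink n
  smooth_φ : ContMDiff (𝓡 n) 𝓘(ℝ, Mink n) ∞ φ
  smooth_η : ContMDiff (𝓡 n) 𝓘(ℝ, Mink n) ∞ η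
  mem_hyp : ∀ p, φ p ∈ Hyp n
  immersion : ∀ p, Function.Injective (mfderiv (𝓡 n) 𝓘(ℝ, Mink n) φ p)
  unit_η : ∀ p, mink (η p) (η p) = 1
  tangent_η : ∀ p, mink (η p) (φ p) = 0
  normal_η : ∀ p (v : TangentSpace (𝓡 n) p),
    mink (η p) (mfderiv (𝓡 n) 𝓘(ℝ, Mink n) φ p v) = 0

namespace OrientedHypersurface

variable {n : ℕ} {M : Type*} [TopologicalSpace M] [ChartedSpace (EuclideanSpace ℝ (Fin n)) M]

/-- The light cone map `ψ = φ - η`. -/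
def ψ (S : OrientedHypersurface n M) (p : M) : Mink n := S.φ p - S.η p

theorem ψ_null (S : OrientedHypersurface n M) (p : M) : mink (S.ψ p) (S.ψ p) = 0 := by
  have h1 := (S.mem_hyp p).1
  have h2 := S.unit_η p
  have h3 := S.tangent_η p
  simp only [mink, ψ, Prod.fst_sub, Prod.snd_sub, inner_sub_left, inner_sub_right] at *
  rw [real_inner_comm (S.η p).2 (S.φ p).2]
  linarith

theorem ψ_pos (S : OrientedHypersurface n M) (p : M) : 0 < (S.ψ p).1 := by
  obtain ⟨h1, h0⟩ := S.mem_hyp p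
  have h2 := S.unit_η p
  have h3 := S.tangent_η p
  simp only [mink, ψ, Prod.fst_sub] at *
  have hc := real_inner_mul_inner_self_le (S.η p).2 (S.φ p).2
  by_contra hneg
  have e1 : ⟪(S.φ p).2, (S.φ p).2⟫ = (S.φ p).1 * (S.φ p).1 - 1 := by linarith
  have e2 : ⟪(S.η p).2, (S.η p).2⟫ = 1 + (S.η p).1 * (S.η p).1 := by linarith
  have e3 : ⟪(S.η p).2, (S.φ p).2⟫ = (S.η p).1 * (S.φ p).1 := by linarith
  rw [e1, e2, e3] at hc
  nlinarith

theorem ψ_norm (S : OrientedHypersurface n M) (p : M) : ‖(S.ψ p).2‖ = (S.ψ p).1 := by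
  have h := S.ψ_null p
  simp only [mink, real_inner_self_eq_norm_mul_norm] at h
  have h0 := S.ψ_pos p
  have := norm_nonneg (S.ψ p).2
  nlinarith

/-- The hyperbolic Gauss map `G`, determined by `ψ = ψ₀ (1, G)`. -/
def gauss (S : OrientedHypersurface n M) (p : M) : Sph n :=
  ⟨(S.ψ p).1⁻¹ • (S.ψ p).2, by
    have h0 := S.ψ_pos p
    rw [mem_sphere_zero_iff_norm, norm_smul, S.ψ_norm, Real.norm_eq_abs,
      abs_of_pos (inv_pos.mpr h0), inv_mul_cancel₀ h0.ne']⟩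

/-- The horospherical support function, determined by `ψ = exp support • (1, G)`. -/
def support (S : OrientedHypersurface n M) (p : M) : ℝ := Real.log (S.ψ p).1

theorem ψ_eq (S : OrientedHypersurface n M) (p : M) :
    S.ψ p = Real.exp (S.support p) • nullVec (S.gauss p) := by
  have h0 := S.ψ_pos p
  rw [support, Real.exp_log h0]
  ext1
  · simp [nullVec]
  · simp [nullVec, gauss, smul_smul, mul_inv_cancel₀ h0.ne']

/-- `gauss p` is the point at infinity of the unique horosphere through `φ p` whose outward unit
normal at `φ p` is `η p`. -/
theorem horosphere_iff (S : OrientedHypersurface n M) (p : M) (x : Sph n) (s : ℝ) :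
    (S.φ p ∈ horosphere x s ∧ S.η p = horosphereNormal x s (S.φ p)) ↔
      (x = S.gauss p ∧ s = S.support p) := by
  constructor
  · rintro ⟨-, h⟩
    have hψ : S.ψ p = Real.exp s • nullVec x := by
      rw [ψ, h, horosphereNormal]; abel
    have h1 : (S.ψ p).1 = Real.exp s := by rw [hψ]; simp [nullVec]
    refine ⟨?_, by rw [support, h1, Real.log_exp]⟩
    apply Subtype.ext
    simp only [gauss, h1]
    rw [hψ]
    simp [nullVec, smul_smul]
  · rintro ⟨rfl, rfl⟩
    have hψ := S.ψ_eq p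
    refine ⟨⟨S.mem_hyp p, ?_⟩, by rw [horosphereNormal, ← hψ, ψ]; abel⟩
    have h1 : mink (S.φ p) (S.ψ p) = -1 := by
      have h1 := (S.mem_hyp p).1
      have h3 := S.tangent_η p
      simp only [mink, ψ, Prod.fst_sub, Prod.snd_sub, inner_sub_right] at *
      rw [real_inner_comm (S.φ p).2 (S.η p).2] at h3
      linarith
    have h2 : mink (S.φ p) (S.ψ p) =
        Real.exp (S.support p) * mink (S.φ p) (nullVec (S.gauss p)) := by
      rw [hψ]; simp only [mink, Prod.smul_fst, Prod.smul_snd, inner_smul_right, smul_eq_mul]; ring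
    rw [h2] at h1
    rw [Real.exp_neg]
    field_simp
    linarith

/-- The horospherical metric `ψ^*⟨ , ⟩`, as a quadratic form. -/
def horosphericalForm (S : OrientedHypersurface n M) (p : M) (v : TangentSpace (𝓡 n) p) : ℝ :=
  mink (n := n) (mfderiv (𝓡 n) 𝓘(ℝ, Mink n) S.ψ p v) (mfderiv (𝓡 n) 𝓘(ℝ, Mink n) S.ψ p v)

/-- The length of a tangent vector for the metric induced by the immersion `φ`. -/
def inducedNorm (S : OrientedHypersurface n M) (p : M) (v : TangentSpace (𝓡 n) p) : ℝ :=
  Real.sqrt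
    (mink (n := n) (mfderiv (𝓡 n) 𝓘(ℝ, Mink n) S.φ p v) (mfderiv (𝓡 n) 𝓘(ℝ, Mink n) S.φ p v))

/-- The hypersurface is complete: its induced metric is complete. -/
def IsComplete (S : OrientedHypersurface n M) : Prop := IsCompleteNorm S.inducedNorm

/-- `κ` is a principal curvature at `p`: an eigenvalue of the shape operator `A` defined by
`dη = -dφ ∘ A`. -/
def IsPrincipalCurvature (S : OrientedHypersurface n M) (p : M) (κ : ℝ) : Prop :=
  ∃ v : TangentSpace (𝓡 n) p, v ≠ 0 ∧
    mfderiv (𝓡 n) 𝓘(ℝ, Mink n) S.η p v = -(κ • (mfderiv (𝓡 n) 𝓘(ℝ, Mink n) S.φ p v : Mink n))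

/-- Uniform weak horospherical convexity. -/
def IsUniformlyWeaklyHorosphericallyConvex (S : OrientedHypersurface n M) : Prop :=
  ∃ κ₀ : ℝ, -1 < κ₀ ∧ ∀ p κ, S.IsPrincipalCurvature p κ → κ₀ ≤ κ

/-- The immersion is proper. As `Hyp n` is closed in `Mink n`, properness as a map into
hyperbolic space is the same as properness as a map into `Mink n`. -/
def IsProper (S : OrientedHypersurface n M) : Prop := IsProperMap S.φ

/-- The passage to the Poincaré ball model, `(x₀, x') ↦ x' / (1 + x₀)`. -/
def toBall (X : Mink n) : Euc n := (1 + X.1)⁻¹ • X.2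

/-- The boundary at infinity: the set of points of the ideal sphere which are limits of points of
the hypersurface in the closed ball model. -/
def boundaryAtInfinity (S : OrientedHypersurface n M) : Set (Sph n) :=
  {y | (y : Euc n) ∈ closure (Set.range fun p => toBall (S.φ p))}

/-- Admissible hypersurfaces. -/
structure IsAdmissible (S : OrientedHypersurface n M) : Prop where
  proper : S.IsProper
  complete : S.IsComplete
  convex : S.IsUniformlyWeaklyHorosphericallyConvex
  injective : Function.Injective S.gauss

end OrientedHypersurface

/-! ### Conformal metrics on open subsets of the sphere -/

variable {n : ℕ}

/-- The extension of a function on the sphere to the ambient space (away from the origin) as a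
function which is constant on rays from the origin. -/
def radialExt (ρ : Sph n → ℝ) (y : Euc n) : ℝ :=
  Function.extend (Subtype.val : Sph n → Euc n) ρ 0 (‖y‖⁻¹ • y)

/-- The gradient of `ρ` for the round metric: as the extension is constant on rays, its Euclidean
gradient at a point of the sphere is tangent to the sphere and is the spherical gradient. -/
def sphGrad (ρ : Sph n → ℝ) (x : Sph n) : Euc n := gradient (radialExt ρ) (x : Euc n)

/-- The Hessian of `ρ` for the round metric, on tangent vectors `u, v ⟂ x`: the covariant
derivative on the sphere is the tangential part of the Euclidean derivative, so that it is
`⟪D_u (grad ρ), v⟫`, that is, the Euclidean second derivative of the extension. -/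
def sphHess (ρ : Sph n → ℝ) (x : Sph n) (u v : Euc n) : ℝ :=
  fderiv ℝ (fderiv ℝ (radialExt ρ)) (x : Euc n) u v

/-- The 2-tensor `P = -∇²ρ + dρ ⊗ dρ - ½ (|∇ρ|² - 1) g` at `x`, on tangent vectors `u, v ⟂ x`. -/
def tensorP (ρ : Sph n → ℝ) (x : Sph n) (u v : Euc n) : ℝ :=
  -sphHess ρ x u v + ⟪sphGrad ρ x, u⟫ * ⟪sphGrad ρ x, v⟫
    - 1 / 2 * (‖sphGrad ρ x‖ ^ 2 - 1) * ⟪u, v⟫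

/-- The length, for the round metric (induced by the inclusion of the sphere into Euclidean space),
of the image of the tangent vector `v` under the differential of a map `f` into the sphere. -/
def roundLength {M : Type*} [TopologicalSpace M] [ChartedSpace (EuclideanSpace ℝ (Fin n)) M]
    (f : M → Sph n) (p : M) (v : TangentSpace (𝓡 n) p) : ℝ :=
  norm (E := Euc n) (mfderiv (𝓡 n) 𝓘(ℝ, Euc n) (fun q => (f q : Euc n)) p v)

/-- The length of a tangent vector of `Ω` for the metric `exp (2ρ) g`, with `g` the round
metric. -/
def conformalNorm (Ω : TopologicalSpace.Opens (Sph n)) (ρ : Sph n → ℝ) (x : Ω)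
    (v : TangentSpace (𝓡 n) x) : ℝ :=
  Real.exp (ρ x) * roundLength (fun y : Ω => (y : Sph n)) x v

/-- The metric `exp (2ρ) g` is a smooth complete conformal metric on `Ω`, and its 2-tensor `P` is
bounded with respect to it. Only the values of `ρ` on `Ω` matter. -/
structure IsRealizable (Ω : TopologicalSpace.Opens (Sph n)) (ρ : Sph n → ℝ) : Prop where
  smooth : ContMDiffOn (𝓡 n) 𝓘(ℝ, ℝ) ∞ ρ (Ω : Set (Sph n))
  complete : IsCompleteNorm (conformalNorm Ω ρ)
  bounded : ∃ C : ℝ, ∀ x ∈ Ω, ∀ u v : Euc n, ⟪(x : Euc n), u⟫ = 0 → ⟪(x : Euc n), v⟫ = 0 →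
    |tensorP ρ x u v| ≤ C * Real.exp (2 * ρ x) * ‖u‖ * ‖v‖

/-- The map `φ^t` associated with the conformal metric `exp (2ρ) g`. -/
def flowMap (ρ : Sph n → ℝ) (t : ℝ) (x : Sph n) : Mink n :=
  (Real.exp (ρ x + t) / 2 * (1 + Real.exp (-2 * (ρ x + t)) * (1 + ‖sphGrad ρ x‖ ^ 2))) •
      ((1, (x : Euc n)) : Mink n) +
    Real.exp (-(ρ x + t)) • ((0, -(x : Euc n) + sphGrad ρ x) : Mink n)

end HoroConvex

end

noncomputable section

namespace HoroConvex

/-! Both directions rest on the light cone map `ψ = exp ρ • (1, x)`. A point `φ` of hyperbolic space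
with `⟨φ, ψ⟩ = -1` and `⟨φ, dψ⟩ = 0` is determined by `ρ` and its gradient: it is `flowMap ρ 0 x`
(`eq_flowMap`). So a hypersurface parametrized by its Gauss map and a conformal factor on the sphere
carry the same data.

Write `Q = halfSubP`, that is, `1/2 - P` with an index of `P` raised by the metric `exp (2ρ) g`.
Then `dψ u = coneDeriv u` and `dφ u = coneDeriv (Q u)` (`fderiv_flowExt`), while `coneDeriv` is
isometric from `exp (2ρ) g` to the Minkowski form (`mink_coneDeriv`). Hence the induced metric is
`|Q u|` measured in `exp (2ρ) g`. As `dη = dφ - dψ`, an eigenvalue `s ≠ 0` of `Q` corresponds to the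
principal curvature `κ` with `s (1 + κ) = 1`.

For (1), weak horospherical convexity excludes the principal curvature `-1`, so `ψ` and therefore
the Gauss map are immersions, and the inverse function theorem gives `Ω` and `ρ`. The bound `κ ≥ κ₀
> -1` gives `0 < s ≤ (1 + κ₀)⁻¹`; as `Q` is symmetric, it is bounded, hence so is `P`, and the
induced metric is at most a constant times `exp (2ρ) g`, which is therefore complete. For (2),
adding `t` to `ρ` multiplies the norm of `P` by `exp (-2t)`; once that norm is at most `1/4`, the
quadratic form of `Q` lies between `1/4` and `3/4`, which yields immersion, completeness and
convexity.

Properness and the boundary at infinity need that `√(1 + |∇ρ|²) + exp ρ` tends to infinity at the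
frontier of `Ω` (`IsRealizable.tendsto_atTop`). Along a unit speed great circle put `m = exp (-ρ/2)`
and `β = gradSize`. Then `|m'| ≤ β/2`, and bounded `P` gives `|β'| ≤ C m⁻³`. So `m` stays above half
its initial value for a controlled time; meanwhile the conformal speed `m⁻²` is bounded and
completeness keeps the curve in `Ω`. Thus `Ω` contains a round ball about `x` of radius controlled
by `ρ` and `|∇ρ|` at `x` (`greatCircle_mem`). The time coordinate of `flowMap` dominates the same
quantity, and in the ball model its distance to `x` is at most a constant over it. -/

instance factFinrankEuc (n : ℕ) : Fact (Module.finrank ℝ (Euc n) = n + 1) :=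
  ⟨finrank_euclideanSpace_fin⟩

/-! ### Riemannian distance under Lipschitz maps. -/

section Length

variable {E : Type*} [NormedAddCommGroup E] [NormedSpace ℝ E]
  {H : Type*} [TopologicalSpace H] {I : ModelWithCorners ℝ E H}
  {M : Type*} [TopologicalSpace M] [ChartedSpace H M]
  {N : Type*} [TopologicalSpace N] [ChartedSpace H N]

/-- A `C¹` map which multiplies lengths of tangent vectors by at most `c` multiplies Riemannian
distances by at most `c`. -/
theorem riemannianEDist_map_le [∀ x : M, ENorm (TangentSpace I x)]
    [∀ x : N, ENorm (TangentSpace I x)] [∀ x : N, ENormSMulClass ℝ (TangentSpace I x)]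
    {F : M → N} (hF : ContMDiff I I 1 F) {c : ℝ≥0∞} (hc0 : c ≠ 0) (hc : c ≠ ⊤)
    (h : ∀ p (v : TangentSpace I p), ‖(mfderiv I I F p v : TangentSpace I (F p))‖ₑ ≤ c * ‖v‖ₑ)
    (p q : M) :
    Manifold.riemannianEDist I (F p) (F q) ≤ c * Manifold.riemannianEDist I p q := by
  -- With the constant moved to the left, the distance from `p` to `q` can be approximated from
  -- above by lengths of paths, whose images under `F` compete for the distance between the images.
  rw [mul_comm, ← ENNReal.div_le_iff hc0 hc]
  refine le_of_forall_gt fun r hr => ?_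
  obtain ⟨γ, h0, h1, hγ, hlen⟩ := Manifold.exists_lt_of_riemannianEDist_lt hr
  refine lt_of_le_of_lt ?_ hlen
  rw [ENNReal.div_le_iff hc0 hc, mul_comm]
  refine (Manifold.riemannianEDist_le_pathELength (γ := F ∘ γ) (a := 0) (b := 1)
    (hF.comp_contMDiffOn hγ) (by simp [h0]) (by simp [h1]) zero_le_one).trans ?_
  rw [Manifold.pathELength_eq_lintegral_mfderiv_Ioo, Manifold.pathELength_eq_lintegral_mfderiv_Ioo,
    ← MeasureTheory.lintegral_const_mul' _ _ hc]
  refine MeasureTheory.setLIntegral_mono' measurableSet_Ioo fun t ht => ?_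
  have hd : MDifferentiableAt 𝓘(ℝ, ℝ) I γ t :=
    ((hγ t ⟨ht.1.le, ht.2.le⟩).contMDiffAt (Icc_mem_nhds ht.1 ht.2)).mdifferentiableAt one_ne_zero
  rw [mfderiv_comp t ((hF (γ t)).mdifferentiableAt one_ne_zero) hd]
  exact h _ _

end Length

/-! ### The inverse function theorem on manifolds. -/

section InverseFunction

variable {E : Type*} [NormedAddCommGroup E] [NormedSpace ℝ E] [FiniteDimensional ℝ E]
  {M : Type*} [TopologicalSpace M] [ChartedSpace E M] [IsManifold 𝓘(ℝ, E) ∞ M]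
  {N : Type*} [TopologicalSpace N] [ChartedSpace E N]

/-- The inverse function theorem for manifolds of the same dimension. -/
theorem exists_smooth_localRightInverse {f : M → N} {p : M}
    (hf : ContMDiffAt 𝓘(ℝ, E) 𝓘(ℝ, E) ∞ f p)
    (hinj : Function.Injective (mfderiv 𝓘(ℝ, E) 𝓘(ℝ, E) f p)) :
    ∃ g : N → M, ContMDiffAt 𝓘(ℝ, E) 𝓘(ℝ, E) ∞ g (f p) ∧ g (f p) = p ∧
      ∀ᶠ q in 𝓝 (f p), f (g q) = q := by
  set h : E → E := writtenInExtChartAt 𝓘(ℝ, E) 𝓘(ℝ, E) p f with hh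
  set z := extChartAt 𝓘(ℝ, E) p p with hz
  have hcd : ContDiffAt ℝ ∞ h z := by
    have := (contMDiffAt_iff.1 hf).2
    rwa [modelWithCornersSelf_coe, range_id, contDiffWithinAt_univ] at this
  have hmd : MDifferentiableAt 𝓘(ℝ, E) 𝓘(ℝ, E) f p := hf.mdifferentiableAt (by simp)
  have hder : mfderiv 𝓘(ℝ, E) 𝓘(ℝ, E) f p = fderiv ℝ h z := by
    rw [hmd.mfderiv, modelWithCornersSelf_coe, range_id, fderivWithin_univ]
  rw [hder] at hinj
  let e : E ≃L[ℝ] E := (LinearEquiv.ofInjectiveEndo (fderiv ℝ h z : E →ₗ[ℝ] E)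
    hinj).toContinuousLinearEquiv
  have he : HasFDerivAt h (e : E →L[ℝ] E) z := by
    have h1 := (hcd.differentiableAt (by simp)).hasFDerivAt
    convert h1 using 1
    ext v
    rfl
  have hn : (∞ : WithTop ℕ∞) ≠ 0 := by simp
  set l := hcd.localInverse he hn with hl
  have hzq : h z = extChartAt 𝓘(ℝ, E) (f p) (f p) := by
    simp [hh, hz, writtenInExtChartAt]
  have hl1 : l (extChartAt 𝓘(ℝ, E) (f p) (f p)) = z := by
    rw [← hzq]; exact hcd.localInverse_apply_image he hn
  have hl2 : ContDiffAt ℝ ∞ l (extChartAt 𝓘(ℝ, E) (f p) (f p)) := by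
    rw [← hzq]; exact hcd.to_localInverse he hn
  have hl3 : ∀ᶠ w in 𝓝 (extChartAt 𝓘(ℝ, E) (f p) (f p)), h (l w) = w := by
    rw [← hzq]; exact (hcd.hasStrictFDerivAt' he hn).eventually_right_inverse
  have hgp : (extChartAt 𝓘(ℝ, E) p).symm (l (extChartAt 𝓘(ℝ, E) (f p) (f p))) = p := by
    rw [hl1, hz, extChartAt_to_inv]
  have hsm : ContMDiffAt 𝓘(ℝ, E) 𝓘(ℝ, E) ∞
      (fun q => (extChartAt 𝓘(ℝ, E) p).symm (l (extChartAt 𝓘(ℝ, E) (f p) q))) (f p) := by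
    have h1 : ContMDiffAt 𝓘(ℝ, E) 𝓘(ℝ, E) ∞ (extChartAt 𝓘(ℝ, E) (f p)) (f p) :=
      contMDiffAt_extChartAt
    have h2 : ContMDiffAt 𝓘(ℝ, E) 𝓘(ℝ, E) ∞ (fun q => l (extChartAt 𝓘(ℝ, E) (f p) q)) (f p) :=
      ContMDiffAt.comp (f p) hl2.contMDiffAt h1
    have h3 : ContMDiffAt 𝓘(ℝ, E) 𝓘(ℝ, E) ∞ (extChartAt 𝓘(ℝ, E) p).symm
        (l (extChartAt 𝓘(ℝ, E) (f p) (f p))) := by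
      rw [hl1]
      exact (contMDiffOn_extChartAt_symm p).contMDiffAt (extChartAt_target_mem_nhds p)
    exact ContMDiffAt.comp (f p) h3 h2
  refine ⟨_, hsm, hgp, ?_⟩
  have hc1 : ∀ᶠ q in 𝓝 (f p), h (l (extChartAt 𝓘(ℝ, E) (f p) q)) = extChartAt 𝓘(ℝ, E) (f p) q :=
    (continuousAt_extChartAt (I := 𝓘(ℝ, E)) (f p)).eventually hl3
  have hfg : ContinuousAt
      (fun q => f ((extChartAt 𝓘(ℝ, E) p).symm (l (extChartAt 𝓘(ℝ, E) (f p) q)))) (f p) :=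
    ContinuousAt.comp (g := f) (by rw [hgp]; exact hf.continuousAt) hsm.continuousAt
  have hc2 := hfg.eventually_mem (s := (extChartAt 𝓘(ℝ, E) (f p)).source)
    (by rw [hgp]; exact extChartAt_source_mem_nhds (f p))
  filter_upwards [hc1, hc2, extChartAt_source_mem_nhds (I := 𝓘(ℝ, E)) (f p)] with q h1 h2 h3
  exact (extChartAt 𝓘(ℝ, E) (f p)).injOn h2 h3 h1

/-- A smooth map which is an injective immersion between manifolds of the same dimension is open
and has a smooth inverse. -/
theorem exists_smooth_inverse [Nonempty M] {f : M → N} (hf : ContMDiff 𝓘(ℝ, E) 𝓘(ℝ, E) ∞ f)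
    (hd : ∀ p, Function.Injective (mfderiv 𝓘(ℝ, E) 𝓘(ℝ, E) f p)) (hinj : Function.Injective f) :
    IsOpen (range f) ∧ ∃ g : N → M, (∀ p, g (f p) = p) ∧
      ContMDiffOn 𝓘(ℝ, E) 𝓘(ℝ, E) ∞ g (range f) := by
  have hopen : IsOpen (range f) := by
    rw [isOpen_iff_mem_nhds]
    rintro _ ⟨p, rfl⟩
    obtain ⟨g, -, -, h3⟩ := exists_smooth_localRightInverse (hf p) (hd p)
    filter_upwards [h3] with q hq using ⟨_, hq⟩
  refine ⟨hopen, Function.invFun f, Function.leftInverse_invFun hinj, ?_⟩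
  rintro _ ⟨p, rfl⟩
  obtain ⟨g, h1, -, h3⟩ := exists_smooth_localRightInverse (hf p) (hd p)
  refine (h1.congr_of_eventuallyEq ?_).contMDiffWithinAt
  filter_upwards [h3] with q hq
  -- By injectivity, the set-theoretic inverse agrees near `f p` with the local smooth right
  -- inverse, since both send `q = f (g q)` to `g q`.
  conv_lhs => rw [← hq]
  exact Function.leftInverse_invFun hinj _

end InverseFunction

/-! ### Tangent vectors of the sphere as Euclidean vectors. -/

section SphereInclusion

variable {n : ℕ}

theorem contMDiff_sphere_val : ContMDiff (𝓡 n) 𝓘(ℝ, Euc n) ∞ (fun x : Sph n => (x : Euc n)) :=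
  contMDiff_coe_sphere

variable {M : Type*} [TopologicalSpace M] [ChartedSpace (EuclideanSpace ℝ (Fin n)) M]

/-- The differential of a map into the sphere, with values in Euclidean space. -/
def sphDeriv (f : M → Sph n) (p : M) : TangentSpace (𝓡 n) p →L[ℝ] Euc n :=
  mfderiv (𝓡 n) 𝓘(ℝ, Euc n) (fun q => (f q : Euc n)) p

theorem range_mfderiv_sphere_val (x : Sph n) :
    (mfderiv (𝓡 n) 𝓘(ℝ, Euc n) ((↑) : Sph n → Euc n) x :
      TangentSpace (𝓡 n) x →L[ℝ] Euc n).range = (ℝ ∙ (x : Euc n))ᗮ := by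
  convert! range_mvfderiv_subtypeVal (E := Euc n) x

theorem mfderiv_sphere_val_injective (x : Sph n) :
    Function.Injective (mfderiv (𝓡 n) 𝓘(ℝ, Euc n) ((↑) : Sph n → Euc n) x) := by
  convert! injective_mvfderiv_subtypeVal_sphere (E := Euc n) x

theorem roundLength_eq (f : M → Sph n) (p : M) (v : TangentSpace (𝓡 n) p) :
    roundLength f p v = ‖sphDeriv f p v‖ := rfl

theorem sphDeriv_eq {f : M → Sph n} {p : M} (hf : MDifferentiableAt (𝓡 n) (𝓡 n) f p)
    (v : TangentSpace (𝓡 n) p) :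
    sphDeriv f p v = mfderiv (𝓡 n) 𝓘(ℝ, Euc n) (fun x : Sph n => (x : Euc n)) (f p)
      (mfderiv (𝓡 n) (𝓡 n) f p v) := by
  have h := mfderiv_comp p
    ((contMDiff_sphere_val (n := n) (f p)).mdifferentiableAt (by simp)) hf
  exact congrArg (fun l => l v) h

theorem inner_sphDeriv {f : M → Sph n} {p : M} (hf : MDifferentiableAt (𝓡 n) (𝓡 n) f p)
    (v : TangentSpace (𝓡 n) p) : ⟪(f p : Euc n), sphDeriv f p v⟫ = 0 := by
  have h := range_mfderiv_sphere_val (f p)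
  have h1 : sphDeriv f p v ∈ (ℝ ∙ (f p : Euc n))ᗮ := by
    rw [← h, sphDeriv_eq hf]; exact ⟨_, rfl⟩
  exact Submodule.mem_orthogonal_singleton_iff_inner_right.1 h1

theorem sphDeriv_injective {f : M → Sph n} {p : M} (hf : MDifferentiableAt (𝓡 n) (𝓡 n) f p)
    (hinj : Function.Injective (mfderiv (𝓡 n) (𝓡 n) f p)) :
    Function.Injective (sphDeriv f p) := by
  intro v w h
  rw [sphDeriv_eq hf, sphDeriv_eq hf] at h
  exact hinj (mfderiv_sphere_val_injective (f p) h)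

theorem exists_sphDeriv_eq {f : M → Sph n} {p : M} (hf : MDifferentiableAt (𝓡 n) (𝓡 n) f p)
    (hinj : Function.Injective (mfderiv (𝓡 n) (𝓡 n) f p)) {u : Euc n}
    (hu : ⟪(f p : Euc n), u⟫ = 0) : ∃ v, sphDeriv f p v = u := by
  have h := range_mfderiv_sphere_val (f p)
  have h1 : u ∈ (ℝ ∙ (f p : Euc n))ᗮ := Submodule.mem_orthogonal_singleton_iff_inner_right.2 hu
  rw [← h] at h1
  obtain ⟨w, hw⟩ := h1
  let l : EuclideanSpace ℝ (Fin n) →L[ℝ] EuclideanSpace ℝ (Fin n) := mfderiv (𝓡 n) (𝓡 n) f p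
  have hs : Function.Surjective (l : EuclideanSpace ℝ (Fin n) →ₗ[ℝ] EuclideanSpace ℝ (Fin n)) :=
    LinearMap.surjective_of_injective hinj
  obtain ⟨v, rfl⟩ := hs w
  exact ⟨v, (sphDeriv_eq hf v).trans hw⟩

variable (Ω : TopologicalSpace.Opens (Sph n))

theorem contMDiff_opens_val : ContMDiff (𝓡 n) (𝓡 n) ∞ (Subtype.val : Ω → Sph n) :=
  contMDiff_subtype_val

/-- The inclusion has a left inverse `r`, smooth near `x` whatever its value off `Ω`; the chain rule
then gives a left inverse of the differential. -/
theorem mfderiv_opens_val_injective (x : Ω) :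
    Function.Injective (mfderiv (𝓡 n) (𝓡 n) (Subtype.val : Ω → Sph n) x) := by
  classical
  let r : Sph n → Ω := fun y => if h : y ∈ Ω then ⟨y, h⟩ else x
  have hr : ContMDiffAt (𝓡 n) (𝓡 n) ∞ r (x : Sph n) := by
    rw [← ContMDiffAt.subtypeVal_comp_iff]
    refine (contMDiffAt_id (I := 𝓡 n) (n := ∞)).congr_of_eventuallyEq ?_
    filter_upwards [Ω.isOpen.mem_nhds x.2] with y hy
    have hy' : y ∈ Ω := hy
    simp [r, hy']
  have hid : r ∘ (Subtype.val : Ω → Sph n) = id := by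
    ext y
    simp [r]
  have h := mfderiv_comp (I := 𝓡 n) (I' := 𝓡 n) (I'' := 𝓡 n) x (g := r)
    (f := (Subtype.val : Ω → Sph n)) (hr.mdifferentiableAt (by simp))
    ((contMDiff_opens_val Ω x).mdifferentiableAt (by simp))
  rw [hid, mfderiv_id] at h
  intro v w hvw
  have h1 : v = w := by
    have h2 := congrArg (fun l => l v) h
    have h3 := congrArg (fun l => l w) h
    exact (h2.trans (congrArg (mfderiv (𝓡 n) (𝓡 n) r (x : Sph n)) hvw)).trans h3.symm
  exact h1

end SphereInclusion

variable {n : ℕ}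

/-! ### Gradient and Hessian through the radial extension. -/

section Radial

theorem norm_sph (x : Sph n) : ‖(x : Euc n)‖ = 1 := by simp

theorem inner_self_sph (x : Sph n) : ⟪(x : Euc n), (x : Euc n)⟫ = 1 := by
  rw [real_inner_self_eq_norm_sq, norm_sph, one_pow]

theorem sph_ne_zero (x : Sph n) : (x : Euc n) ≠ 0 := by
  intro h
  have := norm_sph x
  simp [h] at this

/-- Radial projection onto the sphere. -/
def radialProj (y : ({y : Euc n | y ≠ 0} : Set (Euc n))) : Sph n :=
  ⟨‖(y : Euc n)‖⁻¹ • (y : Euc n), by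
    have : ‖(y : Euc n)‖ ≠ 0 := norm_ne_zero_iff.2 y.2
    simp [norm_smul, this]⟩

theorem radialExt_apply (ρ : Sph n → ℝ) {y : Euc n} (hy : y ≠ 0) :
    radialExt ρ y = ρ (radialProj ⟨y, hy⟩) :=
  Subtype.val_injective.extend_apply ρ 0 (radialProj ⟨y, hy⟩)

theorem radialExt_coe (ρ : Sph n → ℝ) (x : Sph n) : radialExt ρ (x : Euc n) = ρ x := by
  rw [radialExt_apply ρ (sph_ne_zero x)]
  congr 1
  ext1
  simp [radialProj]

theorem radialExt_smul (ρ : Sph n → ℝ) {c : ℝ} (hc : 0 < c) (y : Euc n) :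
    radialExt ρ (c • y) = radialExt ρ y := by
  unfold radialExt
  congr 1
  rw [norm_smul, smul_smul, Real.norm_eq_abs, abs_of_pos hc]
  congr 1
  field_simp

theorem contDiffAt_radialExt {ρ : Sph n → ℝ} {x : Sph n}
    (h : ContMDiffAt (𝓡 n) 𝓘(ℝ, ℝ) ∞ ρ x) : ContDiffAt ℝ ∞ (radialExt ρ) (x : Euc n) := by
  let U : TopologicalSpace.Opens (Euc n) := ⟨{y | y ≠ 0}, isOpen_ne⟩
  have h1 : ContMDiff 𝓘(ℝ, Euc n) 𝓘(ℝ, Euc n) ∞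
      (fun y : U => ‖(y : Euc n)‖⁻¹ • (y : Euc n)) := by
    intro y
    have h2 : ContDiffAt ℝ ∞ (fun y : Euc n => ‖y‖⁻¹ • y) (y : Euc n) :=
      ((contDiffAt_norm ℝ y.2).inv (norm_ne_zero_iff.2 y.2)).smul contDiffAt_id
    exact contMDiffAt_subtype_iff.2 h2.contMDiffAt
  have h3 : ContMDiff 𝓘(ℝ, Euc n) (𝓡 n) ∞ (fun y : U => radialProj y) :=
    ContMDiff.codRestrict_sphere h1 fun y => (radialProj y).2
  let x' : U := ⟨x, sph_ne_zero x⟩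
  have hx' : radialProj x' = x := by ext1; simp [x', radialProj]
  have h4 : ContMDiffAt 𝓘(ℝ, Euc n) 𝓘(ℝ, ℝ) ∞ (fun y : U => ρ (radialProj y)) x' :=
    ContMDiffAt.comp x' (by rw [hx']; exact h) (h3 x')
  have h5 : ContMDiffAt 𝓘(ℝ, Euc n) 𝓘(ℝ, ℝ) ∞ (fun y : U => radialExt ρ (y : Euc n)) x' := by
    refine h4.congr_of_eventuallyEq (Eventually.of_forall fun y => radialExt_apply ρ y.2)
  exact contMDiffAt_iff_contDiffAt.1 ((contMDiffAt_subtype_iff (U := U) (x := x')).1 h5)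

theorem contDiffAt_gradient {F : Euc n → ℝ} {y : Euc n} (h : ContDiffAt ℝ ∞ F y) :
    ContDiffAt ℝ ∞ (gradient F) y :=
  ((InnerProductSpace.toDual ℝ (Euc n)).symm.contDiff.contDiffAt).comp y
    (h.fderiv_right (m := ∞) (by simp))

theorem inner_gradient (F : Euc n → ℝ) (y u : Euc n) : ⟪gradient F y, u⟫ = fderiv ℝ F y u := by
  simp [gradient]

theorem inner_fderiv_gradient {F : Euc n → ℝ} {y : Euc n} (h : ContDiffAt ℝ ∞ F y) (u v : Euc n) :
    ⟪fderiv ℝ (gradient F) y u, v⟫ = fderiv ℝ (fderiv ℝ F) y u v := by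
  have h1 : HasFDerivAt (fderiv ℝ F) (fderiv ℝ (fderiv ℝ F) y) y :=
    ((h.fderiv_right (m := ∞) (by simp)).differentiableAt (by simp)).hasFDerivAt
  have h2 := ((InnerProductSpace.toDual ℝ (Euc n)).symm.toContinuousLinearEquiv.toContinuousLinearMap.hasFDerivAt
    (x := fderiv ℝ F y)).comp y h1
  have h3 : fderiv ℝ (gradient F) y = _ := h2.fderiv
  rw [h3]
  simp

theorem fderiv_radialExt_self {ρ : Sph n → ℝ} {y : Euc n}
    (h : DifferentiableAt ℝ (radialExt ρ) y) : fderiv ℝ (radialExt ρ) y y = 0 := by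
  have h1 : HasDerivAt (fun c : ℝ => c • y) y 1 := by
    simpa using (hasDerivAt_id (1 : ℝ)).smul_const y
  have h2 : HasDerivAt (fun c : ℝ => radialExt ρ (c • y)) (fderiv ℝ (radialExt ρ) y y) 1 :=
    HasFDerivAt.comp_hasDerivAt (l := radialExt ρ) (1 : ℝ) (by rw [one_smul]; exact h.hasFDerivAt) h1
  have h3 : HasDerivAt (fun c : ℝ => radialExt ρ (c • y)) 0 1 := by
    refine (hasDerivAt_const (1 : ℝ) (radialExt ρ y)).congr_of_eventuallyEq ?_
    filter_upwards [Ioi_mem_nhds (zero_lt_one' ℝ)] with c hc using radialExt_smul ρ hc y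
  exact h2.unique h3

variable {ρ : Sph n → ℝ} {x : Sph n}

theorem inner_sphGrad_self (h : ContMDiffAt (𝓡 n) 𝓘(ℝ, ℝ) ∞ ρ x) :
    ⟪sphGrad ρ x, (x : Euc n)⟫ = 0 := by
  rw [sphGrad, inner_gradient]
  exact fderiv_radialExt_self ((contDiffAt_radialExt h).differentiableAt (by simp))

theorem sphHess_symm (h : ContMDiffAt (𝓡 n) 𝓘(ℝ, ℝ) ∞ ρ x) (u v : Euc n) :
    sphHess ρ x u v = sphHess ρ x v u :=
  (contDiffAt_radialExt h).isSymmSndFDerivAt (by simpa using WithTop.coe_le_coe.2 (le_top : (2 : ℕ∞) ≤ ⊤)) u v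

/-- Differentiate Euler's relation `fderiv R y y = 0`, valid for all `y` near `x`, in the direction
`u`. -/
theorem sphHess_self (h : ContMDiffAt (𝓡 n) 𝓘(ℝ, ℝ) ∞ ρ x) (u : Euc n) :
    sphHess ρ x u x = -⟪sphGrad ρ x, u⟫ := by
  have hR := contDiffAt_radialExt h
  have h1 : HasFDerivAt (fderiv ℝ (radialExt ρ)) (fderiv ℝ (fderiv ℝ (radialExt ρ)) x)
      (x : Euc n) :=
    ((hR.fderiv_right (m := ∞) (by simp)).differentiableAt (by simp)).hasFDerivAt
  have h2 := h1.clm_apply (hasFDerivAt_id (x : Euc n))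
  have h3 : HasFDerivAt (fun y => fderiv ℝ (radialExt ρ) y (id y)) (0 : Euc n →L[ℝ] ℝ)
      (x : Euc n) := by
    refine (hasFDerivAt_const (0 : ℝ) (x : Euc n)).congr_of_eventuallyEq ?_
    have h4 : ∀ᶠ y in 𝓝 (x : Euc n), ContDiffAt ℝ 1 (radialExt ρ) y :=
      (hR.of_le (m := 1) (by simp)).eventually (by simp)
    filter_upwards [h4] with y hy
    exact fderiv_radialExt_self (hy.differentiableAt (by simp))
  have h5 := congrArg (fun l => l u) (h2.unique h3)
  simp at h5
  rw [sphHess, sphGrad, inner_gradient]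
  linarith

end Radial

/-! ### The light cone map, the map `flowMap`, and their differentials. -/

section LightCone

/-- The differential of the gradient of `ρ`, as an endomorphism of the ambient space. -/
def gradDeriv (ρ : Sph n → ℝ) (x : Sph n) : Euc n →L[ℝ] Euc n :=
  fderiv ℝ (gradient (radialExt ρ)) (x : Euc n)

/-- The endomorphism `½ - P`, with the index of `P` raised by the metric `exp (2ρ) g`. -/
def halfSubP (ρ : Sph n → ℝ) (x : Sph n) : Euc n →L[ℝ] Euc n :=
  (1 / 2 : ℝ) • ContinuousLinearMap.id ℝ (Euc n) - Real.exp (-2 * ρ x) •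
    (-(gradDeriv ρ x + (innerSL ℝ (sphGrad ρ x)).smulRight (x : Euc n)) +
      (innerSL ℝ (sphGrad ρ x)).smulRight (sphGrad ρ x) -
      (1 / 2 * (‖sphGrad ρ x‖ ^ 2 - 1)) • ContinuousLinearMap.id ℝ (Euc n))

theorem halfSubP_apply (ρ : Sph n → ℝ) (x : Sph n) (u : Euc n) :
    halfSubP ρ x u = (1 / 2 : ℝ) • u - Real.exp (-2 * ρ x) •
      (-(gradDeriv ρ x u + ⟪sphGrad ρ x, u⟫ • (x : Euc n)) + ⟪sphGrad ρ x, u⟫ • sphGrad ρ x -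
        (1 / 2 * (‖sphGrad ρ x‖ ^ 2 - 1)) • u) := by
  simp [halfSubP]

variable {ρ : Sph n → ℝ} {x : Sph n}

theorem inner_gradDeriv (h : ContMDiffAt (𝓡 n) 𝓘(ℝ, ℝ) ∞ ρ x) (u v : Euc n) :
    ⟪gradDeriv ρ x u, v⟫ = sphHess ρ x u v :=
  inner_fderiv_gradient (contDiffAt_radialExt h) u v

theorem inner_halfSubP (h : ContMDiffAt (𝓡 n) 𝓘(ℝ, ℝ) ∞ ρ x) (u : Euc n) {v : Euc n}
    (hv : ⟪(x : Euc n), v⟫ = 0) :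
    ⟪halfSubP ρ x u, v⟫ = 1 / 2 * ⟪u, v⟫ - Real.exp (-2 * ρ x) * tensorP ρ x u v := by
  rw [halfSubP_apply, tensorP, ← inner_gradDeriv h]
  simp only [inner_sub_left, inner_add_left, inner_neg_left, real_inner_smul_left, hv]
  ring

/-- By `sphHess_self`, the radial component of `gradDeriv ρ x u` is `-⟪∇ρ, u⟫`; the term `⟪∇ρ, u⟫ •
x` in `halfSubP` is there to cancel it, so that the operator preserves the tangent space. -/
theorem inner_self_halfSubP (h : ContMDiffAt (𝓡 n) 𝓘(ℝ, ℝ) ∞ ρ x) {u : Euc n}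
    (hu : ⟪(x : Euc n), u⟫ = 0) : ⟪(x : Euc n), halfSubP ρ x u⟫ = 0 := by
  rw [real_inner_comm, halfSubP_apply]
  have h1 := inner_sphGrad_self h
  simp only [inner_sub_left, inner_add_left, inner_neg_left, real_inner_smul_left,
    inner_gradDeriv h, sphHess_self h, inner_self_sph, h1]
  rw [real_inner_comm, hu]
  ring

theorem tensorP_symm (h : ContMDiffAt (𝓡 n) 𝓘(ℝ, ℝ) ∞ ρ x) (u v : Euc n) :
    tensorP ρ x u v = tensorP ρ x v u := by
  rw [tensorP, tensorP, sphHess_symm h, real_inner_comm u v]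
  ring

/-- The light cone map `exp ρ (1, x)` of the metric `exp (2ρ) g`, extended to the ambient space. -/
def coneExt (ρ : Sph n → ℝ) (y : Euc n) : Mink n := Real.exp (radialExt ρ y) • ((1, y) : Mink n)

/-- The time coordinate of `flowMap ρ 0`, extended to the ambient space. -/
def flowTime (ρ : Sph n → ℝ) (y : Euc n) : ℝ :=
  Real.exp (radialExt ρ y) / 2 *
    (1 + Real.exp (-2 * radialExt ρ y) * (1 + ‖gradient (radialExt ρ) y‖ ^ 2))

/-- The extension of `flowMap ρ 0` to the ambient space. -/
def flowExt (ρ : Sph n → ℝ) (y : Euc n) : Mink n :=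
  flowTime ρ y • ((1, y) : Mink n) +
    Real.exp (-radialExt ρ y) • ((0, -y + gradient (radialExt ρ) y) : Mink n)

theorem coneExt_coe (ρ : Sph n → ℝ) (x : Sph n) :
    coneExt ρ x = Real.exp (ρ x) • nullVec x := by
  rw [coneExt, radialExt_coe, nullVec]

theorem flowExt_coe (ρ : Sph n → ℝ) (x : Sph n) : flowExt ρ x = flowMap ρ 0 x := by
  simp only [flowExt, flowTime, flowMap, radialExt_coe, add_zero, sphGrad]

theorem contDiffAt_coneExt (h : ContMDiffAt (𝓡 n) 𝓘(ℝ, ℝ) ∞ ρ x) :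
    ContDiffAt ℝ ∞ (coneExt ρ) (x : Euc n) :=
  (contDiffAt_radialExt h).exp.smul (contDiffAt_const.prodMk contDiffAt_id)

theorem contDiffAt_flowTime (h : ContMDiffAt (𝓡 n) 𝓘(ℝ, ℝ) ∞ ρ x) :
    ContDiffAt ℝ ∞ (flowTime ρ) (x : Euc n) := by
  have h1 := contDiffAt_radialExt h
  have h2 := contDiffAt_gradient h1
  exact (h1.exp.div_const 2).mul
    (contDiffAt_const.add ((contDiffAt_const.mul h1).exp.mul (contDiffAt_const.add (h2.norm_sq ℝ))))

theorem contDiffAt_flowExt (h : ContMDiffAt (𝓡 n) 𝓘(ℝ, ℝ) ∞ ρ x) :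
    ContDiffAt ℝ ∞ (flowExt ρ) (x : Euc n) := by
  have h1 := contDiffAt_radialExt h
  have h2 := contDiffAt_gradient h1
  exact ((contDiffAt_flowTime h).smul (contDiffAt_const.prodMk contDiffAt_id)).add
    (h1.neg.exp.smul (contDiffAt_const.prodMk (contDiffAt_id.neg.add h2)))

/-- The differential at `x` of the light cone map `exp ρ (1, x)`, on vectors tangent to the
sphere. -/
def coneDeriv (ρ : Sph n → ℝ) (x : Sph n) (w : Euc n) : Mink n :=
  Real.exp (ρ x) • ((⟪sphGrad ρ x, w⟫, ⟪sphGrad ρ x, w⟫ • (x : Euc n) + w) : Mink n)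

section Curve

variable {c : ℝ → Euc n} {s : ℝ} {u : Euc n}

theorem hasDerivAt_radialExt_comp (h : ContMDiffAt (𝓡 n) 𝓘(ℝ, ℝ) ∞ ρ x) (hc : HasDerivAt c u s)
    (hx : c s = x) : HasDerivAt (fun τ => radialExt ρ (c τ)) ⟪sphGrad ρ x, u⟫ s := by
  rw [sphGrad, inner_gradient]
  refine HasFDerivAt.comp_hasDerivAt (l := radialExt ρ) s ?_ hc
  rw [hx]
  exact ((contDiffAt_radialExt h).differentiableAt (by simp)).hasFDerivAt

theorem hasDerivAt_gradient_comp (h : ContMDiffAt (𝓡 n) 𝓘(ℝ, ℝ) ∞ ρ x) (hc : HasDerivAt c u s)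
    (hx : c s = x) :
    HasDerivAt (fun τ => gradient (radialExt ρ) (c τ)) (gradDeriv ρ x u) s := by
  refine HasFDerivAt.comp_hasDerivAt (l := gradient (radialExt ρ)) s ?_ hc
  rw [hx]
  exact ((contDiffAt_gradient (contDiffAt_radialExt h)).differentiableAt (by simp)).hasFDerivAt

theorem hasDerivAt_flowTime_comp (h : ContMDiffAt (𝓡 n) 𝓘(ℝ, ℝ) ∞ ρ x) (hc : HasDerivAt c u s)
    (hx : c s = x) :
    HasDerivAt (fun τ => flowTime ρ (c τ)) (Real.exp (ρ x) * ⟪sphGrad ρ x, halfSubP ρ x u⟫) s := by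
  have h1 := hasDerivAt_radialExt_comp h hc hx
  have h2 := hasDerivAt_gradient_comp h hc hx
  have h3 := (h1.exp.div_const 2).mul (((h1.const_mul (-2)).exp.mul (h2.norm_sq.const_add 1)).const_add 1)
  refine h3.congr_deriv ?_
  rw [halfSubP_apply]
  simp only [Pi.mul_apply, hx, radialExt_coe, ← sphGrad.eq_def]
  simp only [inner_sub_right, inner_add_right, inner_neg_right, real_inner_smul_right,
    real_inner_self_eq_norm_sq, inner_sphGrad_self h]
  rw [show -2 * ρ x = -(ρ x) + -(ρ x) by ring, Real.exp_add, Real.exp_neg]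
  have := (Real.exp_pos (ρ x)).ne'
  field_simp
  ring

/-- This is the identity `dφ = dψ ∘ Q`, the source of all curvature information. The curve has to
meet the sphere only at time `s`, so straight lines are enough to compute the Fréchet derivative. -/
theorem hasDerivAt_flowExt_comp (h : ContMDiffAt (𝓡 n) 𝓘(ℝ, ℝ) ∞ ρ x) (hc : HasDerivAt c u s)
    (hx : c s = x) :
    HasDerivAt (fun τ => flowExt ρ (c τ)) (coneDeriv ρ x (halfSubP ρ x u)) s := by
  have h1 := hasDerivAt_radialExt_comp h hc hx
  have h2 := hasDerivAt_gradient_comp h hc hx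
  have h3 := hasDerivAt_flowTime_comp h hc hx
  have h4 := (h3.smul ((hasDerivAt_const s (1 : ℝ)).prodMk hc)).add
    (h1.neg.exp.smul ((hasDerivAt_const s (0 : ℝ)).prodMk (hc.neg.add h2)))
  refine h4.congr_deriv ?_
  rw [coneDeriv]
  ext1
  · simp
  · simp only [Prod.snd_add, Pi.neg_apply, Pi.add_apply, hx, Prod.smul_mk]
    generalize ⟪sphGrad ρ x, halfSubP ρ x u⟫ = k
    rw [halfSubP_apply, flowTime]
    simp only [radialExt_coe, ← sphGrad.eq_def]
    rw [show -2 * ρ x = -(ρ x) + -(ρ x) by ring, Real.exp_add, Real.exp_neg]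
    have := (Real.exp_pos (ρ x)).ne'
    match_scalars <;> field_simp
    ring

theorem hasDerivAt_coneExt_comp (h : ContMDiffAt (𝓡 n) 𝓘(ℝ, ℝ) ∞ ρ x) (hc : HasDerivAt c u s)
    (hx : c s = x) : HasDerivAt (fun τ => coneExt ρ (c τ)) (coneDeriv ρ x u) s := by
  have h1 := hasDerivAt_radialExt_comp h hc hx
  have h4 := h1.exp.smul ((hasDerivAt_const s (1 : ℝ)).prodMk hc)
  refine h4.congr_deriv ?_
  rw [coneDeriv, hx, radialExt_coe]
  ext1
  · simp
  · simp only [Prod.snd_add, Prod.smul_mk]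
    module

end Curve

theorem fderiv_flowExt (h : ContMDiffAt (𝓡 n) 𝓘(ℝ, ℝ) ∞ ρ x) (u : Euc n) :
    fderiv ℝ (flowExt ρ) x u = coneDeriv ρ x (halfSubP ρ x u) := by
  have hc : HasDerivAt (fun τ : ℝ => (x : Euc n) + τ • u) u 0 := by
    simpa using ((hasDerivAt_id (0 : ℝ)).smul_const u).const_add (x : Euc n)
  have h1 := hasDerivAt_flowExt_comp h hc (by simp)
  have h2 : HasDerivAt (fun τ : ℝ => flowExt ρ ((x : Euc n) + τ • u))
      (fderiv ℝ (flowExt ρ) x u) 0 :=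
    HasFDerivAt.comp_hasDerivAt (l := flowExt ρ) 0
      (by simpa using ((contDiffAt_flowExt h).differentiableAt (by simp)).hasFDerivAt) hc
  exact h2.unique h1

theorem fderiv_coneExt (h : ContMDiffAt (𝓡 n) 𝓘(ℝ, ℝ) ∞ ρ x) (u : Euc n) :
    fderiv ℝ (coneExt ρ) x u = coneDeriv ρ x u := by
  have hc : HasDerivAt (fun τ : ℝ => (x : Euc n) + τ • u) u 0 := by
    simpa using ((hasDerivAt_id (0 : ℝ)).smul_const u).const_add (x : Euc n)
  have h1 := hasDerivAt_coneExt_comp h hc (by simp)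
  have h2 : HasDerivAt (fun τ : ℝ => coneExt ρ ((x : Euc n) + τ • u))
      (fderiv ℝ (coneExt ρ) x u) 0 :=
    HasFDerivAt.comp_hasDerivAt (l := coneExt ρ) 0
      (by simpa using ((contDiffAt_coneExt h).differentiableAt (by simp)).hasFDerivAt) hc
  exact h2.unique h1

/-! Minkowski products -/

/-- The part of `coneDeriv` along `(1, x)` is null and orthogonal to `(0, w)` for tangent `w`, so
only the scaled tangential part contributes. -/
theorem mink_coneDeriv {w w' : Euc n} (hw : ⟪(x : Euc n), w⟫ = 0) (hw' : ⟪(x : Euc n), w'⟫ = 0) :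
    mink (coneDeriv ρ x w) (coneDeriv ρ x w') = Real.exp (2 * ρ x) * ⟪w, w'⟫ := by
  rw [real_inner_comm] at hw
  simp only [mink, coneDeriv, Prod.smul_fst, Prod.smul_snd, smul_eq_mul, real_inner_smul_left,
    real_inner_smul_right, inner_add_left, inner_add_right, inner_self_sph, hw, hw']
  rw [show 2 * ρ x = ρ x + ρ x by ring, Real.exp_add]
  ring

theorem mink_nullVec_coneDeriv {w : Euc n} (hw : ⟪(x : Euc n), w⟫ = 0) :
    mink (nullVec x) (coneDeriv ρ x w) = 0 := by
  simp only [mink, coneDeriv, nullVec, Prod.smul_fst, Prod.smul_snd, smul_eq_mul,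
    real_inner_smul_right, inner_add_right, inner_self_sph, hw]
  ring

theorem flowMap_zero (ρ : Sph n → ℝ) (x : Sph n) : flowMap ρ 0 x =
    (Real.exp (ρ x) / 2 * (1 + Real.exp (-2 * ρ x) * (1 + ‖sphGrad ρ x‖ ^ 2)),
      (Real.exp (ρ x) / 2 * (1 + Real.exp (-2 * ρ x) * (1 + ‖sphGrad ρ x‖ ^ 2))) • (x : Euc n) +
        Real.exp (-ρ x) • (-(x : Euc n) + sphGrad ρ x)) := by
  simp [flowMap]

theorem mink_flowMap_coneDeriv (h : ContMDiffAt (𝓡 n) 𝓘(ℝ, ℝ) ∞ ρ x) {w : Euc n}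
    (hw : ⟪(x : Euc n), w⟫ = 0) : mink (flowMap ρ 0 x) (coneDeriv ρ x w) = 0 := by
  have h1 := inner_sphGrad_self h
  simp only [flowMap_zero, mink, coneDeriv, Prod.smul_fst, Prod.smul_snd, smul_eq_mul,
    real_inner_smul_left, real_inner_smul_right, inner_add_left, inner_add_right, inner_neg_left,
    inner_self_sph, hw, h1]
  ring

theorem mink_flowMap_nullVec (h : ContMDiffAt (𝓡 n) 𝓘(ℝ, ℝ) ∞ ρ x) :
    mink (flowMap ρ 0 x) (nullVec x) = -Real.exp (-ρ x) := by
  have h1 := inner_sphGrad_self h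
  simp only [flowMap_zero, mink, nullVec, real_inner_smul_left, inner_add_left, inner_neg_left,
    inner_self_sph, h1]
  ring

theorem flowMap_mem_hyp (h : ContMDiffAt (𝓡 n) 𝓘(ℝ, ℝ) ∞ ρ x) : flowMap ρ 0 x ∈ Hyp n := by
  have h1 := inner_sphGrad_self h
  have h2 := h1
  rw [real_inner_comm] at h2
  refine ⟨?_, ?_⟩
  · simp only [flowMap_zero, mink, real_inner_smul_left, real_inner_smul_right, inner_add_left,
      inner_add_right, inner_neg_left, inner_neg_right, inner_self_sph, h1, h2,
      real_inner_self_eq_norm_sq (sphGrad ρ x)]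
    rw [show -2 * ρ x = -(ρ x) + -(ρ x) by ring, Real.exp_add, Real.exp_neg]
    have := (Real.exp_pos (ρ x)).ne'
    field_simp
    ring
  · rw [flowMap_zero]
    positivity

end LightCone

/-! ### Transfer of completeness along maps. -/

section CompleteNorm

variable {M : Type*} [TopologicalSpace M] [ChartedSpace (EuclideanSpace ℝ (Fin n)) M]
  {N : Type*} [TopologicalSpace N] [ChartedSpace (EuclideanSpace ℝ (Fin n)) N]

/-- The extended norms on the tangent spaces given by a length function. -/
@[reducible] def lengthENorm (nrm : ∀ p : M, TangentSpace (𝓡 n) p → ℝ) (p : M) :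
    ENorm (TangentSpace (𝓡 n) p) := ⟨fun v => ENNReal.ofReal (nrm p v)⟩

theorem lengthENorm_smulClass {nrm : ∀ p : M, TangentSpace (𝓡 n) p → ℝ}
    (h : ∀ p (r : ℝ) v, nrm p (r • v) = |r| * nrm p v) (p : M) :
    @ENormSMulClass ℝ (TangentSpace (𝓡 n) p) _ (lengthENorm nrm p) _ :=
  let _ := lengthENorm nrm p
  ⟨fun r v => by
    change ENNReal.ofReal (nrm p (r • v)) = ‖r‖ₑ * ENNReal.ofReal (nrm p v)
    rw [h, ENNReal.ofReal_mul (abs_nonneg r), Real.enorm_eq_ofReal_abs]⟩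

/-- Completeness passes to `M` along a map `F : M → N` with a continuous left inverse which
multiplies lengths of tangent vectors by at most `c`. -/
theorem IsCompleteNorm.of_map {nM : ∀ p : M, TangentSpace (𝓡 n) p → ℝ}
    {nN : ∀ p : N, TangentSpace (𝓡 n) p → ℝ} (hN : IsCompleteNorm nN)
    (hhom : ∀ p (r : ℝ) v, nN p (r • v) = |r| * nN p v)
    {F : M → N} (hF : ContMDiff (𝓡 n) (𝓡 n) 1 F) {g : N → M} (hg : Continuous g)
    (hgF : ∀ p, g (F p) = p) {c : ℝ} (hc : 0 < c)
    (h : ∀ p (v : TangentSpace (𝓡 n) p), nN (F p) (mfderiv (𝓡 n) (𝓡 n) F p v) ≤ c * nM p v) :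
    IsCompleteNorm nM := by
  let _ := lengthENorm nM
  let _ := lengthENorm nN
  have _ := lengthENorm_smulClass hhom
  intro u hu
  have hle := riemannianEDist_map_le (I := 𝓡 n) hF (c := ENNReal.ofReal c) (by simpa using hc)
    ENNReal.ofReal_ne_top (fun p v => by
      change ENNReal.ofReal _ ≤ _ * ENNReal.ofReal _
      rw [← ENNReal.ofReal_mul hc.le]
      exact ENNReal.ofReal_le_ofReal (h p v))
  obtain ⟨p, hp⟩ := hN (fun i => F (u i)) (by
    intro ε hε
    obtain ⟨k, hk⟩ := hu (ε / ENNReal.ofReal c) (ENNReal.div_pos hε.ne' ENNReal.ofReal_ne_top)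
    refine ⟨k, fun i hi j hj => (hle (u i) (u j)).trans_lt ?_⟩
    rw [mul_comm]
    exact (ENNReal.lt_div_iff_mul_lt (Or.inl (by simpa using hc))
      (Or.inl ENNReal.ofReal_ne_top)).1 (hk i hi j hj))
  refine ⟨g p, ?_⟩
  have := (hg.tendsto p).comp hp
  simpa [Function.comp_def, hgF] using this

end CompleteNorm

/-! ### Curves of bounded conformal speed stay in the domain. -/

section ConformalNorm

variable {Ω : TopologicalSpace.Opens (Sph n)} {ρ : Sph n → ℝ}

theorem conformalNorm_smul (x : Ω) (r : ℝ) (v : TangentSpace (𝓡 n) x) :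
    conformalNorm Ω ρ x (r • v) = |r| * conformalNorm Ω ρ x v := by
  have h : sphDeriv (fun y : Ω => (y : Sph n)) x (r • v) =
    r • sphDeriv (fun y : Ω => (y : Sph n)) x v := map_smul _ r v
  rw [conformalNorm, conformalNorm, roundLength_eq, roundLength_eq, h, norm_smul,
    Real.norm_eq_abs]
  ring

/-- A curve in the domain of a complete conformal metric does not reach the boundary as long as
its speed is bounded. -/
theorem IsCompleteNorm.mem_of_speed_le (hΩ : IsCompleteNorm (conformalNorm Ω ρ)) {γ : ℝ → Sph n}
    (hγ : ContMDiff 𝓘(ℝ, ℝ) (𝓡 n) ∞ γ) {γ' : ℝ → Euc n}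
    (hγ' : ∀ s, HasDerivAt (fun τ => (γ τ : Euc n)) (γ' s) s) {T : ℝ} (hT : 0 < T)
    (hmem : ∀ s ∈ Ico 0 T, γ s ∈ Ω) {K : ℝ}
    (hK : ∀ s ∈ Ico 0 T, Real.exp (ρ (γ s)) * ‖γ' s‖ ≤ K) : γ T ∈ Ω := by
  classical
  let _ := lengthENorm (conformalNorm Ω ρ)
  have _ := lengthENorm_smulClass (conformalNorm_smul (Ω := Ω) (ρ := ρ))
  have h0 : γ 0 ∈ Ω := hmem 0 ⟨le_rfl, hT⟩
  have hK0 : 0 ≤ K := le_trans (by positivity) (hK 0 ⟨le_rfl, hT⟩)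
  -- A lift of `γ` to `Ω`; the default value `γ 0` plays no role, as `δ` is used only on `[0, T)`.
  let δ : ℝ → Ω := fun s => if h : γ s ∈ Ω then ⟨γ s, h⟩ else ⟨γ 0, h0⟩
  have hδ : ∀ s ∈ Ico 0 T, (δ s : Sph n) = γ s := fun s hs => by
    have := hmem s hs
    simp [δ, this]
  have hle1 : ∀ a ∈ Ico 0 T, ∀ b ∈ Ico 0 T, a ≤ b →
      Manifold.riemannianEDist (𝓡 n) (δ a) (δ b) ≤ ENNReal.ofReal (K * |a - b|) := by
    intro a ha b hb hab
    have hsub : ∀ s ∈ Icc a b, s ∈ Ico 0 T := fun s hs => ⟨ha.1.trans hs.1, hs.2.trans_lt hb.2⟩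
    have hcd : ContMDiffOn 𝓘(ℝ, ℝ) (𝓡 n) 1 δ (Icc a b) := by
      refine ContMDiffOn.of_le (n := ∞) (fun s hs => ?_) (by simp)
      rw [← ContMDiffWithinAt.subtypeVal_comp_iff]
      exact (hγ s).contMDiffWithinAt.congr
        (fun τ hτ => hδ τ (hsub τ hτ)) (hδ s (hsub s hs))
    refine (Manifold.riemannianEDist_le_pathELength hcd rfl rfl hab).trans ?_
    rw [Manifold.pathELength_eq_lintegral_mfderiv_Ioo]
    have hb1 : ∀ s ∈ Ioo a b, ‖mfderiv 𝓘(ℝ, ℝ) (𝓡 n) δ s 1‖ₑ ≤ ENNReal.ofReal K := by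
      intro s hs
      have hs' := hsub s ⟨hs.1.le, hs.2.le⟩
      have hd : MDifferentiableAt 𝓘(ℝ, ℝ) (𝓡 n) δ s :=
        ((hcd s ⟨hs.1.le, hs.2.le⟩).contMDiffAt
          (Icc_mem_nhds hs.1 hs.2)).mdifferentiableAt one_ne_zero
      have h1 : HasDerivAt (fun τ => ((δ τ : Sph n) : Euc n)) (γ' s) s := by
        refine (hγ' s).congr_of_eventuallyEq ?_
        filter_upwards [Ioo_mem_nhds hs.1 hs.2] with τ hτ
        rw [hδ τ (hsub τ ⟨hτ.1.le, hτ.2.le⟩)]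
      have h2 := mfderiv_comp (I := 𝓘(ℝ, ℝ)) (I' := 𝓡 n) (I'' := 𝓘(ℝ, Euc n)) s
        (g := fun y : Ω => ((y : Sph n) : Euc n)) (f := δ)
        ((contMDiff_sphere_val.comp (contMDiff_opens_val Ω) (δ s)).mdifferentiableAt (by simp)) hd
      have h3 : sphDeriv (fun y : Ω => (y : Sph n)) (δ s) (mfderiv 𝓘(ℝ, ℝ) (𝓡 n) δ s 1)
          = γ' s := by
        have h4 := congrArg (fun l => l 1) h2
        refine h4.symm.trans ?_
        rw [mfderiv_eq_fderiv]
        have h5 := h1.hasFDerivAt.fderiv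
        simp only [Function.comp_def]
        rw [h5]
        exact one_smul ℝ (γ' s)
      change ENNReal.ofReal (conformalNorm Ω ρ (δ s) (mfderiv 𝓘(ℝ, ℝ) (𝓡 n) δ s 1)) ≤ _
      refine ENNReal.ofReal_le_ofReal ?_
      rw [conformalNorm, roundLength_eq, h3, hδ s hs']
      exact hK s hs'
    refine (MeasureTheory.setLIntegral_mono' measurableSet_Ioo hb1).trans ?_
    rw [MeasureTheory.setLIntegral_const, Real.volume_Ioo, abs_sub_comm,
      abs_of_nonneg (sub_nonneg.2 hab), ENNReal.ofReal_mul hK0]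
  have hle : ∀ a ∈ Ico 0 T, ∀ b ∈ Ico 0 T,
      Manifold.riemannianEDist (𝓡 n) (δ a) (δ b) ≤ ENNReal.ofReal (K * |a - b|) := by
    intro a ha b hb
    rcases le_total a b with h | h
    · exact hle1 a ha b hb h
    · rw [Manifold.riemannianEDist_comm, abs_sub_comm]
      exact hle1 b hb a ha h
  let s : ℕ → ℝ := fun k => T - T * (1 / ((k : ℝ) + 1))
  have hs : Tendsto s atTop (𝓝 T) := by
    simpa [s] using (tendsto_one_div_add_atTop_nhds_zero_nat.const_mul T).const_sub T
  have hsm : ∀ k, s k ∈ Ico 0 T := by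
    intro k
    have h1 : (0 : ℝ) < 1 / ((k : ℝ) + 1) := by positivity
    have h2 : 1 / ((k : ℝ) + 1) ≤ 1 := by
      rw [div_le_one (by positivity)]; linarith [(Nat.cast_nonneg k : (0 : ℝ) ≤ k)]
    constructor
    · simp only [s]; nlinarith
    · simp only [s]; nlinarith
  -- Times increasing to `T` give a Cauchy sequence because `δ` is `K`-Lipschitz. Its limit in `Ω`
  -- must be `γ T`, by uniqueness of limits in the sphere.
  obtain ⟨p, hp⟩ := hΩ (fun k => δ (s k)) (by
    intro ε hε
    obtain ⟨r, hr0, hr⟩ : ∃ r : ℝ, 0 < r ∧ ENNReal.ofReal (K * r) < ε := by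
      have h1 : Tendsto (fun r : ℝ => ENNReal.ofReal (K * r)) (𝓝[>] 0) (𝓝 0) := by
        have : Tendsto (fun r : ℝ => ENNReal.ofReal (K * r)) (𝓝 0) (𝓝 (ENNReal.ofReal (K * 0))) :=
          (ENNReal.continuous_ofReal.comp (continuous_const.mul continuous_id)).tendsto 0
        simp only [mul_zero, ENNReal.ofReal_zero] at this
        exact this.mono_left nhdsWithin_le_nhds
      obtain ⟨r, h2, h3⟩ := ((h1.eventually_lt_const hε).and self_mem_nhdsWithin).exists
      exact ⟨r, h3, h2⟩
    obtain ⟨k, hk⟩ := Metric.cauchySeq_iff.1 hs.cauchySeq r hr0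
    refine ⟨k, fun i hi j hj => (hle _ (hsm i) _ (hsm j)).trans_lt (lt_of_le_of_lt ?_ hr)⟩
    refine ENNReal.ofReal_le_ofReal (mul_le_mul_of_nonneg_left ?_ hK0)
    rw [← Real.dist_eq]
    exact (hk i hi j hj).le)
  have h1 : Tendsto (fun k => γ (s k)) atTop (𝓝 (p : Sph n)) := by
    have := (continuous_subtype_val.tendsto p).comp hp
    refine this.congr fun k => ?_
    exact hδ _ (hsm k)
  have h2 : Tendsto (fun k => γ (s k)) atTop (𝓝 (γ T)) := (hγ.continuous.tendsto T).comp hs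
  rw [tendsto_nhds_unique h2 h1]
  exact p.2

end ConformalNorm

/-! ### Differential inequalities for `exp (-ρ/2)` and `gradSize`. -/

section GradSize

/-- The square root of `exp (-ρ) (1 + |∇ρ|²)`, extended to the ambient space. -/
def gradSize (ρ : Sph n → ℝ) (y : Euc n) : ℝ :=
  √(Real.exp (-radialExt ρ y) * (1 + ‖gradient (radialExt ρ) y‖ ^ 2))

variable {ρ : Sph n → ℝ} {x : Sph n} {c : ℝ → Euc n} {s : ℝ} {u : Euc n}

theorem gradSize_nonneg (ρ : Sph n → ℝ) (y : Euc n) : 0 ≤ gradSize ρ y := Real.sqrt_nonneg _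

theorem norm_sphGrad_le (ρ : Sph n → ℝ) (x : Sph n) :
    ‖sphGrad ρ x‖ ≤ gradSize ρ x * Real.exp (ρ x / 2) := by
  rw [← Real.sqrt_sq (Real.exp_pos (ρ x / 2)).le, gradSize, ← Real.sqrt_mul (by positivity)]
  refine Real.le_sqrt_of_sq_le ?_
  rw [radialExt_coe, ← Real.exp_nat_mul, mul_right_comm, ← Real.exp_add, sphGrad]
  ring_nf
  rw [Real.exp_zero]
  linarith

/-- The weight `exp (-ρ)` is chosen so that the derivative of `exp (-ρ) (1 + |∇ρ|²)` is exactly `-2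
exp (-ρ) P(u, ∇ρ)`: the terms cubic in the gradient cancel, and a bound on `P` is all that is
needed. -/
theorem hasDerivAt_gradSize_comp (h : ContMDiffAt (𝓡 n) 𝓘(ℝ, ℝ) ∞ ρ x) (hc : HasDerivAt c u s)
    (hx : c s = x) : HasDerivAt (fun τ => gradSize ρ (c τ))
      (-Real.exp (-ρ x) * tensorP ρ x u (sphGrad ρ x) / gradSize ρ x) s := by
  have h1 := hasDerivAt_radialExt_comp h hc hx
  have h2 := hasDerivAt_gradient_comp h hc hx
  have h3 := (h1.neg.exp.mul (h2.norm_sq.const_add 1)).sqrt (by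
    simp only [Pi.mul_apply]
    positivity)
  refine h3.congr_deriv ?_
  simp only [Pi.mul_apply, Pi.neg_apply, hx, gradSize]
  have h4 : (0 : ℝ) < √(Real.exp (-radialExt ρ x) * (1 + ‖gradient (radialExt ρ) x‖ ^ 2)) := by
    positivity
  generalize hq : √(Real.exp (-radialExt ρ x) * (1 + ‖gradient (radialExt ρ) x‖ ^ 2)) = q at h4 ⊢
  rw [tensorP, ← inner_gradDeriv h]
  simp only [radialExt_coe, ← sphGrad.eq_def, real_inner_self_eq_norm_sq]
  rw [real_inner_comm (sphGrad ρ x) (gradDeriv ρ x u), real_inner_comm (sphGrad ρ x) u]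
  field_simp
  ring

/-- Since `|∇ρ| ≤ gradSize * exp (ρ/2)`, the denominator `gradSize` cancels, and the remaining
powers of `exp ρ` combine to `exp (3ρ/2)`. -/
theorem abs_deriv_gradSize_le {C : ℝ} (hC : |tensorP ρ x u (sphGrad ρ x)| ≤
      C * Real.exp (2 * ρ x) * ‖u‖ * ‖sphGrad ρ x‖) (hC0 : 0 ≤ C) :
    |-Real.exp (-ρ x) * tensorP ρ x u (sphGrad ρ x) / gradSize ρ x| ≤
      C * (Real.exp (-ρ x / 2))⁻¹ ^ 3 * ‖u‖ := by
  have h0 : 0 < gradSize ρ x := by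
    unfold gradSize
    positivity
  rw [abs_div, abs_mul, abs_neg, abs_of_pos (Real.exp_pos _), abs_of_pos h0, div_le_iff₀ h0]
  have h1 := norm_sphGrad_le ρ x
  have e1 : Real.exp (-ρ x / 2) = (Real.exp (ρ x / 2))⁻¹ := by rw [← Real.exp_neg]; ring_nf
  have e2 : Real.exp (-ρ x) = (Real.exp (ρ x / 2))⁻¹ ^ 2 := by
    rw [← Real.exp_neg, ← Real.exp_nat_mul]; ring_nf
  have e3 : Real.exp (2 * ρ x) = (Real.exp (ρ x / 2)) ^ 4 := by
    rw [← Real.exp_nat_mul]; ring_nf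
  rw [e3] at hC
  rw [e1, e2]
  have hE := Real.exp_pos (ρ x / 2)
  generalize Real.exp (ρ x / 2) = E at *
  calc E⁻¹ ^ 2 * |tensorP ρ x u (sphGrad ρ x)|
      ≤ E⁻¹ ^ 2 * (C * E ^ 4 * ‖u‖ * (gradSize ρ x * E)) := by
        refine mul_le_mul_of_nonneg_left (hC.trans ?_) (by positivity)
        exact mul_le_mul_of_nonneg_left h1 (by positivity)
    _ = C * E⁻¹⁻¹ ^ 3 * ‖u‖ * gradSize ρ x := by
        field_simp

theorem hasDerivAt_exp_neg_half_comp (h : ContMDiffAt (𝓡 n) 𝓘(ℝ, ℝ) ∞ ρ x)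
    (hc : HasDerivAt c u s) (hx : c s = x) :
    HasDerivAt (fun τ => Real.exp (-radialExt ρ (c τ) / 2))
      (Real.exp (-ρ x / 2) * (-⟪sphGrad ρ x, u⟫ / 2)) s := by
  have h1 := ((hasDerivAt_radialExt_comp h hc hx).neg.div_const 2).exp
  simpa only [Pi.neg_apply, hx, radialExt_coe] using h1

theorem abs_deriv_exp_neg_half_le (ρ : Sph n → ℝ) (x : Sph n) (u : Euc n) :
    |Real.exp (-ρ x / 2) * (-⟪sphGrad ρ x, u⟫ / 2)| ≤ gradSize ρ x / 2 * ‖u‖ := by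
  have h1 := abs_real_inner_le_norm (sphGrad ρ x) u
  have h2 := norm_sphGrad_le ρ x
  rw [abs_mul, abs_of_pos (Real.exp_pos _), abs_div, abs_neg, abs_of_pos (zero_lt_two' ℝ)]
  calc Real.exp (-ρ x / 2) * (|⟪sphGrad ρ x, u⟫| / 2)
      ≤ Real.exp (-ρ x / 2) * ((gradSize ρ x * Real.exp (ρ x / 2)) * ‖u‖ / 2) := by
        gcongr
        exact h1.trans (by gcongr)
    _ = gradSize ρ x / 2 * ‖u‖ := by
        rw [neg_div, Real.exp_neg]
        field_simp

/-- Along a curve on which `exp (-ρ / 2)` is at least half its initial value, it decreases at most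
linearly. -/
theorem exp_neg_half_ge_of_half {Ω : TopologicalSpace.Opens (Sph n)}
    (hρ : ContMDiffOn (𝓡 n) 𝓘(ℝ, ℝ) ∞ ρ Ω) {C : ℝ} (hC0 : 0 ≤ C)
    (hC : ∀ x ∈ Ω, ∀ u v : Euc n, ⟪(x : Euc n), u⟫ = 0 → ⟪(x : Euc n), v⟫ = 0 →
      |tensorP ρ x u v| ≤ C * Real.exp (2 * ρ x) * ‖u‖ * ‖v‖)
    {γ : ℝ → Sph n} {γ' : ℝ → Euc n} (hγ' : ∀ s, HasDerivAt (fun τ => (γ τ : Euc n)) (γ' s) s)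
    (hnorm : ∀ s, ‖γ' s‖ = 1) (horth : ∀ s, ⟪(γ s : Euc n), γ' s⟫ = 0) {T : ℝ} (hT : T ≤ 1)
    (hmem : ∀ s ∈ Ico 0 T, γ s ∈ Ω)
    (hm : ∀ s ∈ Ico 0 T, Real.exp (-ρ (γ 0) / 2) / 2 ≤ Real.exp (-ρ (γ s) / 2))
    {s : ℝ} (hs : s ∈ Ico 0 T) :
    Real.exp (-ρ (γ 0) / 2) -
      s * ((gradSize ρ (γ 0) + 8 * C * (Real.exp (-ρ (γ 0) / 2))⁻¹ ^ 3) / 2) ≤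
        Real.exp (-ρ (γ s) / 2) := by
  have hat : ∀ τ ∈ Ico 0 T, ContMDiffAt (𝓡 n) 𝓘(ℝ, ℝ) ∞ ρ (γ τ) := fun τ hτ =>
    hρ.contMDiffAt (Ω.isOpen.mem_nhds (hmem τ hτ))
  have h0 : (0 : ℝ) ∈ Ico 0 T := ⟨le_rfl, hs.1.trans_lt hs.2⟩
  set m0 := Real.exp (-ρ (γ 0) / 2) with hm0
  have hm0' : 0 < m0 := Real.exp_pos _
  set B := gradSize ρ (γ 0) + 8 * C * m0⁻¹ ^ 3 with hB
  have hbeta : ∀ τ ∈ Ico 0 T, gradSize ρ (γ τ) ≤ B := by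
    intro τ hτ
    -- The factor `8` comes from cubing `(m0 / 2)⁻¹`. As `T ≤ 1`, the total increase of `gradSize`
    -- is at most the bound on its derivative.
    have h1 := (convex_Ico (0 : ℝ) T).norm_image_sub_le_of_norm_hasDerivWithin_le
      (f := fun τ => gradSize ρ (γ τ)) (C := 8 * C * m0⁻¹ ^ 3)
      (fun σ hσ => (hasDerivAt_gradSize_comp (hat σ hσ) (hγ' σ) rfl).hasDerivWithinAt)
      (fun σ hσ => by
        have h2 := abs_deriv_gradSize_le (hC (γ σ) (hmem σ hσ) (γ' σ) (sphGrad ρ (γ σ)) (horth σ)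
          (by rw [real_inner_comm]; exact inner_sphGrad_self (hat σ hσ))) hC0
        rw [Real.norm_eq_abs]
        refine h2.trans ?_
        rw [hnorm, mul_one]
        have h3 : (Real.exp (-ρ (γ σ) / 2))⁻¹ ≤ (m0 / 2)⁻¹ :=
          inv_anti₀ (by positivity) (hm σ hσ)
        calc C * (Real.exp (-ρ (γ σ) / 2))⁻¹ ^ 3 ≤ C * (m0 / 2)⁻¹ ^ 3 := by gcongr
          _ = 8 * C * m0⁻¹ ^ 3 := by field_simp; ring) h0 hτ
    rw [Real.norm_eq_abs, Real.norm_eq_abs, sub_zero, abs_of_nonneg hτ.1] at h1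
    have h2 := (le_abs_self _).trans h1
    have h3 : 8 * C * m0⁻¹ ^ 3 * τ ≤ 8 * C * m0⁻¹ ^ 3 * 1 :=
      mul_le_mul_of_nonneg_left (hτ.2.le.trans hT) (by positivity)
    rw [hB]
    linarith
  have h1 := (convex_Ico (0 : ℝ) T).norm_image_sub_le_of_norm_hasDerivWithin_le
    (f := fun τ => Real.exp (-radialExt ρ (γ τ) / 2)) (C := B / 2)
    (fun σ hσ => (hasDerivAt_exp_neg_half_comp (hat σ hσ) (hγ' σ) rfl).hasDerivWithinAt)
    (fun σ hσ => by
      rw [Real.norm_eq_abs]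
      refine (abs_deriv_exp_neg_half_le ρ (γ σ) (γ' σ)).trans ?_
      rw [hnorm, mul_one]
      linarith [hbeta σ hσ]) h0 hs
  rw [Real.norm_eq_abs, Real.norm_eq_abs, sub_zero, abs_of_nonneg hs.1] at h1
  simp only [radialExt_coe] at h1
  have h2 := (neg_abs_le _).trans' (neg_le_neg h1)
  linarith

end GradSize

/-! ### Great circles. -/

section GreatCircle

/-- The great circle through `x` with initial unit velocity `u`. -/
def greatCircle (x : Sph n) {u : Euc n} (hu : ‖u‖ = 1) (hxu : ⟪(x : Euc n), u⟫ = 0) (s : ℝ) :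
    Sph n :=
  ⟨Real.cos s • (x : Euc n) + Real.sin s • u, by
    have h : ‖Real.cos s • (x : Euc n) + Real.sin s • u‖ ^ 2 = 1 := by
      rw [← real_inner_self_eq_norm_sq]
      simp only [inner_add_left, inner_add_right, real_inner_smul_left, real_inner_smul_right,
        inner_self_sph, hxu, real_inner_comm (x : Euc n) u, real_inner_self_eq_norm_sq u, hu]
      nlinarith [Real.sin_sq_add_cos_sq s]
    rw [mem_sphere_zero_iff_norm]
    nlinarith [norm_nonneg (Real.cos s • (x : Euc n) + Real.sin s • u)]⟩

variable (x : Sph n) {u : Euc n} (hu : ‖u‖ = 1) (hxu : ⟪(x : Euc n), u⟫ = 0)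

theorem greatCircle_zero : greatCircle x hu hxu 0 = x := by
  ext1
  simp [greatCircle]

theorem contMDiff_greatCircle : ContMDiff 𝓘(ℝ, ℝ) (𝓡 n) ∞ (greatCircle x hu hxu) := by
  have h : ContMDiff 𝓘(ℝ, ℝ) 𝓘(ℝ, Euc n) ∞
      (fun s : ℝ => Real.cos s • (x : Euc n) + Real.sin s • u) := by
    rw [contMDiff_iff_contDiff]
    fun_prop
  exact ContMDiff.codRestrict_sphere h fun s => (greatCircle x hu hxu s).2

theorem hasDerivAt_greatCircle (s : ℝ) :
    HasDerivAt (fun τ => (greatCircle x hu hxu τ : Euc n))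
      (-Real.sin s • (x : Euc n) + Real.cos s • u) s :=
  ((Real.hasDerivAt_cos s).smul_const (x : Euc n)).add ((Real.hasDerivAt_sin s).smul_const u)

include hu hxu in
theorem norm_deriv_greatCircle (s : ℝ) : ‖-Real.sin s • (x : Euc n) + Real.cos s • u‖ = 1 := by
  have h : ‖-Real.sin s • (x : Euc n) + Real.cos s • u‖ ^ 2 = 1 := by
    rw [← real_inner_self_eq_norm_sq]
    simp only [inner_add_left, inner_add_right, real_inner_smul_left, real_inner_smul_right,
      inner_self_sph, hxu, real_inner_comm (x : Euc n) u, real_inner_self_eq_norm_sq u, hu]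
    nlinarith [Real.sin_sq_add_cos_sq s]
  nlinarith [norm_nonneg (-Real.sin s • (x : Euc n) + Real.cos s • u)]

theorem inner_deriv_greatCircle (s : ℝ) :
    ⟪(greatCircle x hu hxu s : Euc n), -Real.sin s • (x : Euc n) + Real.cos s • u⟫ = 0 := by
  simp only [greatCircle, inner_add_left, inner_add_right, real_inner_smul_left,
    real_inner_smul_right, inner_self_sph, hxu, real_inner_comm (x : Euc n) u,
    real_inner_self_eq_norm_sq u, hu]
  ring

end GreatCircle

/-! ### A quantitative round ball inside the domain. -/

section Escape

variable {Ω : TopologicalSpace.Opens (Sph n)} {ρ : Sph n → ℝ}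

/-- The domain of a complete conformal metric with bounded `P` contains a round ball about each of
its points whose radius is controlled by `ρ` and `∇ρ`. -/
theorem greatCircle_mem (hΩ : IsCompleteNorm (conformalNorm Ω ρ))
    (hρ : ContMDiffOn (𝓡 n) 𝓘(ℝ, ℝ) ∞ ρ Ω) {C : ℝ} (hC0 : 0 ≤ C)
    (hC : ∀ x ∈ Ω, ∀ u v : Euc n, ⟪(x : Euc n), u⟫ = 0 → ⟪(x : Euc n), v⟫ = 0 →
      |tensorP ρ x u v| ≤ C * Real.exp (2 * ρ x) * ‖u‖ * ‖v‖)
    {x : Sph n} (hx : x ∈ Ω) {u : Euc n} (hu : ‖u‖ = 1) (hxu : ⟪(x : Euc n), u⟫ = 0) {θ : ℝ}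
    (hθ0 : 0 ≤ θ)
    (hθ : θ * (√(1 + ‖sphGrad ρ x‖ ^ 2) + 8 * C * Real.exp (ρ x) ^ 2) < 1) :
    greatCircle x hu hxu θ ∈ Ω := by
  set γ := greatCircle x hu hxu with hγdef
  have hγ0 : γ 0 = x := greatCircle_zero x hu hxu
  set m0 := Real.exp (-ρ x / 2) with hm0
  have hm0' : 0 < m0 := Real.exp_pos _
  have hm0i : m0⁻¹ = Real.exp (ρ x / 2) := by rw [hm0, neg_div, Real.exp_neg, inv_inv]
  have hm0s : m0⁻¹ ^ 2 = Real.exp (ρ x) := by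
    rw [hm0i, ← Real.exp_nat_mul]; ring_nf
  set B := gradSize ρ x + 8 * C * m0⁻¹ ^ 3 with hB
  have hB0 : 0 ≤ B := by have := gradSize_nonneg ρ x; positivity
  have hθ1 : θ ≤ 1 := by
    have h1 : 1 ≤ √(1 + ‖sphGrad ρ x‖ ^ 2) := Real.one_le_sqrt.2 (by linarith [sq_nonneg ‖sphGrad ρ x‖])
    have h2 : 0 ≤ 8 * C * Real.exp (ρ x) ^ 2 := by positivity
    nlinarith
  have hθB : θ * B < m0 := by
    have h1 : gradSize ρ x = m0 * √(1 + ‖sphGrad ρ x‖ ^ 2) := by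
      rw [gradSize, radialExt_coe, Real.sqrt_mul (Real.exp_pos _).le, ← Real.exp_half, hm0]
      rfl
    have h2 : B = m0 * (√(1 + ‖sphGrad ρ x‖ ^ 2) + 8 * C * Real.exp (ρ x) ^ 2) := by
      rw [hB, h1, ← hm0s]
      field_simp
    rw [h2, mul_left_comm]
    exact mul_lt_of_lt_one_right hm0' hθ
  -- The closing step of a continuity argument. The linear estimate improves the assumed bound to
  -- `m0 - θ * B / 2`, which is strictly above `m0 / 2` because `θ * B < m0`, so the strict
  -- inequality survives at time `T`.
  have key : ∀ T ∈ Icc 0 θ, (∀ s ∈ Ico 0 T, γ s ∈ Ω ∧ m0 / 2 < Real.exp (-ρ (γ s) / 2)) →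
      γ T ∈ Ω ∧ m0 / 2 < Real.exp (-ρ (γ T) / 2) := by
    intro T hT hgood
    rcases hT.1.eq_or_lt with rfl | hT0
    · rw [hγ0]
      exact ⟨hx, by rw [← hm0]; linarith⟩
    have hge : ∀ s ∈ Ico 0 T, m0 - θ * (B / 2) ≤ Real.exp (-ρ (γ s) / 2) := by
      intro s hs
      have h1 := exp_neg_half_ge_of_half hρ hC0 hC (hasDerivAt_greatCircle x hu hxu)
        (norm_deriv_greatCircle x hu hxu) (inner_deriv_greatCircle x hu hxu) (hT.2.trans hθ1)
        (fun s hs => (hgood s hs).1)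
        (fun s hs => by rw [← hγdef, hγ0]; exact (hgood s hs).2.le) hs
      rw [← hγdef, hγ0, ← hm0, ← hB] at h1
      refine le_trans ?_ h1
      have : s * (B / 2) ≤ θ * (B / 2) :=
        mul_le_mul_of_nonneg_right (hs.2.le.trans hT.2) (by positivity)
      linarith
    have hTΩ : γ T ∈ Ω := by
      refine hΩ.mem_of_speed_le (contMDiff_greatCircle x hu hxu) (hasDerivAt_greatCircle x hu hxu)
        -- The round speed is `1`, so the conformal speed is `exp ρ = m⁻²`, bounded because `m > m0
        -- / 2`.
        hT0 (fun s hs => (hgood s hs).1) (K := (m0 / 2)⁻¹ ^ 2) (fun s hs => ?_)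
      rw [norm_deriv_greatCircle x hu hxu, mul_one, ← hγdef]
      have h1 : Real.exp (ρ (γ s)) = (Real.exp (-ρ (γ s) / 2))⁻¹ ^ 2 := by
        rw [← Real.exp_neg, ← Real.exp_nat_mul]; ring_nf
      rw [h1]
      have h2 := inv_anti₀ (by positivity) (hgood s hs).2.le
      gcongr
    refine ⟨hTΩ, ?_⟩
    have hcont : Tendsto (fun s => Real.exp (-ρ (γ s) / 2)) (𝓝[<] T)
        (𝓝 (Real.exp (-ρ (γ T) / 2))) := by
      have h1 : ContinuousAt ρ (γ T) := (hρ.contMDiffAt (Ω.isOpen.mem_nhds hTΩ)).continuousAt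
      have h2 : ContinuousAt (fun s => Real.exp (-ρ (γ s) / 2)) T :=
        Real.continuous_exp.continuousAt.comp (((h1.comp
          (contMDiff_greatCircle x hu hxu).continuous.continuousAt).neg).div_const 2)
      exact h2.mono_left nhdsWithin_le_nhds
    have hle : m0 - θ * (B / 2) ≤ Real.exp (-ρ (γ T) / 2) := by
      refine ge_of_tendsto hcont ?_
      filter_upwards [Ioo_mem_nhdsLT hT0] with s hs using hge s ⟨hs.1.le, hs.2⟩
    linarith
  -- Real induction on the times up to which the curve is good: `key` gives closedness, while
  -- openness of `Ω` and of the strict inequality lets the interval be extended.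
  let A : Set ℝ := {s | ∀ σ ∈ Icc 0 s, γ σ ∈ Ω ∧ m0 / 2 < Real.exp (-ρ (γ σ) / 2)}
  have hAall : Icc 0 θ ⊆ A := by
    refine IsClosed.Icc_subset_of_forall_exists_gt ?_ ?_ ?_
    · refine isClosed_of_closure_subset fun T hT => ?_
      have hTI : T ∈ Icc 0 θ :=
        (isClosed_Icc.closure_subset_iff.2 inter_subset_right) hT
      have hlt : ∀ s ∈ Ico 0 T, γ s ∈ Ω ∧ m0 / 2 < Real.exp (-ρ (γ s) / 2) := by
        intro s hs
        obtain ⟨a, ha, haA⟩ := mem_closure_iff.1 hT (Ioi s) isOpen_Ioi hs.2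
        exact haA.1 s ⟨hs.1, le_of_lt ha⟩
      refine ⟨fun σ hσ => ?_, hTI⟩
      rcases hσ.2.eq_or_lt with rfl | hlt'
      · exact key _ hTI hlt
      · exact hlt σ ⟨hσ.1, hlt'⟩
    · intro σ hσ
      obtain rfl : σ = 0 := le_antisymm hσ.2 hσ.1
      exact key 0 ⟨le_rfl, hθ0⟩ (fun s hs => absurd hs.2 (not_lt.2 hs.1))
    · rintro s ⟨hsA, hs⟩ b hb
      obtain ⟨h1, h2⟩ := hsA s ⟨hs.1, le_rfl⟩
      have hc1 : ContinuousAt ρ (γ s) := (hρ.contMDiffAt (Ω.isOpen.mem_nhds h1)).continuousAt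
      have hcγ : ContinuousAt γ s := (contMDiff_greatCircle x hu hxu).continuous.continuousAt
      have h3 : ∀ᶠ σ in 𝓝 s, γ σ ∈ Ω := hcγ.eventually_mem (Ω.isOpen.mem_nhds h1)
      have h4 : ∀ᶠ σ in 𝓝 s, m0 / 2 < Real.exp (-ρ (γ σ) / 2) :=
        (Real.continuous_exp.continuousAt.comp ((hc1.comp hcγ).neg.div_const 2)).eventually_const_lt
          h2
      obtain ⟨ε, hε, hball⟩ := Metric.eventually_nhds_iff.1 (h3.and h4)
      refine ⟨min b (s + ε / 2), fun σ hσ => ?_, lt_min hb (by linarith), min_le_left _ _⟩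
      rcases le_total σ s with h5 | h5
      · exact hsA σ ⟨hσ.1, h5⟩
      · refine hball ?_
        rw [Real.dist_eq, abs_of_nonneg (sub_nonneg.2 h5)]
        have := hσ.2.trans (min_le_right _ _)
        linarith
  exact (hAall ⟨hθ0, le_rfl⟩ θ ⟨hθ0, le_rfl⟩).1

end Escape

/-! ### Behaviour at the frontier: properness and the boundary at infinity. -/

section Frontier

variable {Ω : TopologicalSpace.Opens (Sph n)} {ρ : Sph n → ℝ}

/-- The direction `u` is the normalized component of `y` orthogonal to `x`; its length before
normalization is the sine of the angle, nonzero because `y ≠ ±x`. -/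
theorem exists_greatCircle_eq {x y : Sph n} (hxy : x ≠ y) (hlt : Real.arccos ⟪(x : Euc n), y⟫ < Real.pi) :
    ∃ (u : Euc n) (hu : ‖u‖ = 1) (hxu : ⟪(x : Euc n), u⟫ = 0),
      greatCircle x hu hxu (Real.arccos ⟪(x : Euc n), y⟫) = y := by
  have hi := abs_real_inner_le_norm (x : Euc n) (y : Euc n)
  rw [norm_sph, norm_sph, one_mul, abs_le] at hi
  have hlt1 : ⟪(x : Euc n), (y : Euc n)⟫ < 1 := by
    refine lt_of_le_of_ne hi.2 fun h => hxy ?_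
    exact Subtype.ext ((inner_eq_one_iff_of_norm_eq_one (norm_sph x) (norm_sph y)).1 h)
  set θ := Real.arccos ⟪(x : Euc n), (y : Euc n)⟫ with hθ
  have hcos : Real.cos θ = ⟪(x : Euc n), (y : Euc n)⟫ := Real.cos_arccos hi.1 hi.2
  have hsin : 0 < Real.sin θ := Real.sin_pos_of_pos_of_lt_pi (Real.arccos_pos.2 hlt1) hlt
  have hxu : ⟪(x : Euc n), (Real.sin θ)⁻¹ • ((y : Euc n) - Real.cos θ • (x : Euc n))⟫ = 0 := by
    rw [real_inner_smul_right, inner_sub_right, real_inner_smul_right, inner_self_sph, hcos]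
    ring
  have hu : ‖(Real.sin θ)⁻¹ • ((y : Euc n) - Real.cos θ • (x : Euc n))‖ = 1 := by
    have h1 : ‖(y : Euc n) - Real.cos θ • (x : Euc n)‖ ^ 2 = Real.sin θ ^ 2 := by
      rw [norm_sub_sq_real, norm_smul, norm_sph, norm_sph, real_inner_smul_right, real_inner_comm,
        ← hcos, Real.norm_eq_abs, mul_one, sq_abs]
      nlinarith [Real.sin_sq_add_cos_sq θ]
    have h2 : ‖(y : Euc n) - Real.cos θ • (x : Euc n)‖ = Real.sin θ :=
      (sq_eq_sq₀ (norm_nonneg _) hsin.le).1 h1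
    rw [norm_smul, h2, norm_inv, Real.norm_eq_abs, abs_of_pos hsin, inv_mul_cancel₀ hsin.ne']
  refine ⟨_, hu, hxu, ?_⟩
  ext1
  simp only [greatCircle]
  rw [smul_smul, mul_inv_cancel₀ hsin.ne', one_smul]
  abel

/-- For a complete conformal metric with bounded `P`, `|∇ρ|` or `ρ` tends to infinity at the
boundary. -/
theorem IsRealizable.tendsto_atTop (h : IsRealizable Ω ρ) {y : Sph n} (hy : y ∉ Ω) :
    Tendsto (fun x => √(1 + ‖sphGrad ρ x‖ ^ 2) + Real.exp (ρ x)) (𝓝[Ω] y) atTop := by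
  obtain ⟨C₀, hC₀⟩ := h.bounded
  have hC : ∀ x ∈ Ω, ∀ u v : Euc n, ⟪(x : Euc n), u⟫ = 0 → ⟪(x : Euc n), v⟫ = 0 →
      |tensorP ρ x u v| ≤ |C₀| * Real.exp (2 * ρ x) * ‖u‖ * ‖v‖ := by
    intro x hx u v hu hv
    refine (hC₀ x hx u v hu hv).trans ?_
    gcongr
    exact le_abs_self C₀
  rw [Filter.tendsto_atTop]
  intro b
  set B := max b 1 with hB
  have hB1 : 1 ≤ B := le_max_right _ _
  set K := B + 8 * |C₀| * B ^ 2 with hK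
  have hK1 : 1 ≤ K := by
    have : 0 ≤ 8 * |C₀| * B ^ 2 := by positivity
    linarith
  have hθ : Tendsto (fun x : Sph n => Real.arccos ⟪(x : Euc n), (y : Euc n)⟫) (𝓝 y) (𝓝 0) := by
    have h1 : Continuous fun x : Sph n => Real.arccos ⟪(x : Euc n), (y : Euc n)⟫ :=
      Real.continuous_arccos.comp (continuous_subtype_val.inner continuous_const)
    have h2 := h1.tendsto y
    rwa [inner_self_sph, Real.arccos_one] at h2
  have hK0 : 0 < K⁻¹ := by positivity
  filter_upwards [self_mem_nhdsWithin,
    nhdsWithin_le_nhds (hθ.eventually_lt_const hK0)] with x hx hθx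
  refine le_trans (le_max_left b 1) ?_
  -- If the sum were below `B`, both its terms would be, and `Ω` would contain every point at angle
  -- less than `K⁻¹` from `x`, including `y`.
  by_contra hlt
  rw [not_le, ← hB] at hlt
  have hxy : x ≠ y := by rintro rfl; exact hy hx
  have hθ1 : Real.arccos ⟪(x : Euc n), (y : Euc n)⟫ < Real.pi :=
    hθx.trans_le ((inv_le_one_of_one_le₀ hK1).trans (by linarith [Real.pi_gt_three]))
  obtain ⟨u, hu, hxu, huy⟩ := exists_greatCircle_eq hxy hθ1
  refine hy ?_
  rw [← huy]
  refine greatCircle_mem h.complete h.smooth (abs_nonneg C₀) hC hx hu hxu (Real.arccos_nonneg _) ?_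
  have h3 : 0 ≤ √(1 + ‖sphGrad ρ x‖ ^ 2) := Real.sqrt_nonneg _
  have h4 := Real.exp_pos (ρ x)
  have h5 : √(1 + ‖sphGrad ρ x‖ ^ 2) + 8 * |C₀| * Real.exp (ρ x) ^ 2 ≤ K := by
    rw [hK]
    gcongr <;> linarith
  calc _ ≤ Real.arccos ⟪(x : Euc n), (y : Euc n)⟫ * K :=
        mul_le_mul_of_nonneg_left h5 (Real.arccos_nonneg _)
    _ < K⁻¹ * K := mul_lt_mul_of_pos_right hθx (by positivity)
    _ = 1 := inv_mul_cancel₀ (by positivity)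

theorem le_flowMap_fst (ρ : Sph n → ℝ) (x : Sph n) :
    √(1 + ‖sphGrad ρ x‖ ^ 2) + Real.exp (ρ x) ≤ 4 * (flowMap ρ 0 x).1 := by
  have hw : √(1 + ‖sphGrad ρ x‖ ^ 2) ^ 2 = 1 + ‖sphGrad ρ x‖ ^ 2 := Real.sq_sqrt (by positivity)
  rw [flowMap_zero]
  simp only
  have ha := Real.exp_pos (ρ x)
  generalize √(1 + ‖sphGrad ρ x‖ ^ 2) = w at *
  rw [← hw, show -2 * ρ x = -(ρ x) + -(ρ x) by ring, Real.exp_add, Real.exp_neg]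
  generalize Real.exp (ρ x) = a at *
  have e : 4 * (a / 2 * (1 + a⁻¹ * a⁻¹ * w ^ 2)) = (2 * a ^ 2 + 2 * w ^ 2) / a := by
    field_simp
    norm_num
  rw [e, le_div_iff₀ ha]
  nlinarith [sq_nonneg (a - w), sq_nonneg (a + w)]

/-- With `k` the time coordinate, the difference is `(1 + k)⁻¹` times `exp (-ρ) • (-x + ∇ρ) - x`.
Multiplied by `√(1 + |∇ρ|²) + exp ρ`, the two terms of this vector have norms at most `3k` and `4k`,
whence the `7`. -/
theorem norm_toBall_flowMap_sub_le (h : ⟪sphGrad ρ x, (x : Euc n)⟫ = 0) :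
    ‖OrientedHypersurface.toBall (flowMap ρ 0 x) - (x : Euc n)‖ ≤
      7 / (√(1 + ‖sphGrad ρ x‖ ^ 2) + Real.exp (ρ x)) := by
  have hw : √(1 + ‖sphGrad ρ x‖ ^ 2) ^ 2 = 1 + ‖sphGrad ρ x‖ ^ 2 := Real.sq_sqrt (by positivity)
  have hw0 : 0 ≤ √(1 + ‖sphGrad ρ x‖ ^ 2) := Real.sqrt_nonneg _
  have h1 := le_flowMap_fst ρ x
  have ha := Real.exp_pos (ρ x)
  have hz : ‖-(x : Euc n) + sphGrad ρ x‖ = √(1 + ‖sphGrad ρ x‖ ^ 2) := by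
    rw [eq_comm, Real.sqrt_eq_iff_mul_self_eq (by positivity) (norm_nonneg _),
      ← real_inner_self_eq_norm_mul_norm]
    simp only [inner_add_left, inner_add_right, inner_neg_left, inner_neg_right, inner_self_sph, h,
      real_inner_comm (sphGrad ρ x) (x : Euc n), real_inner_self_eq_norm_sq (sphGrad ρ x)]
    ring
  have h2 : (√(1 + ‖sphGrad ρ x‖ ^ 2) + Real.exp (ρ x)) *
      (Real.exp (-ρ x) * √(1 + ‖sphGrad ρ x‖ ^ 2)) ≤ 3 * (flowMap ρ 0 x).1 := by
    rw [flowMap_zero]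
    simp only
    generalize √(1 + ‖sphGrad ρ x‖ ^ 2) = w at *
    rw [← hw, show -2 * ρ x = -(ρ x) + -(ρ x) by ring, Real.exp_add, Real.exp_neg]
    generalize Real.exp (ρ x) = a at *
    have e1 : 3 * (a / 2 * (1 + a⁻¹ * a⁻¹ * w ^ 2)) = (3 / 2 * (a ^ 2 + w ^ 2)) / a := by
      field_simp
    have e2 : (w + a) * (a⁻¹ * w) = ((w + a) * w) / a := by field_simp
    rw [e1, e2]
    refine div_le_div_of_nonneg_right ?_ ha.le
    nlinarith [sq_nonneg (a - w)]
  have h3 : OrientedHypersurface.toBall (flowMap ρ 0 x) - (x : Euc n) =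
      (1 + (flowMap ρ 0 x).1)⁻¹ • (Real.exp (-ρ x) • (-(x : Euc n) + sphGrad ρ x) - x) := by
    have hpos : 1 + (flowMap ρ 0 x).1 ≠ 0 := by nlinarith
    have h4 : (flowMap ρ 0 x).2 = (flowMap ρ 0 x).1 • (x : Euc n) +
        Real.exp (-ρ x) • (-(x : Euc n) + sphGrad ρ x) := by rw [flowMap_zero]
    rw [OrientedHypersurface.toBall, h4]
    generalize (flowMap ρ 0 x).1 = k at *
    generalize Real.exp (-ρ x) • (-(x : Euc n) + sphGrad ρ x) = z
    have h5 : (x : Euc n) = (1 + k)⁻¹ • ((1 + k) • (x : Euc n)) := by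
      rw [smul_smul, inv_mul_cancel₀ hpos, one_smul]
    nth_rewrite 2 [h5]
    module
  have h4 : ‖Real.exp (-ρ x) • (-(x : Euc n) + sphGrad ρ x) - x‖ ≤
      Real.exp (-ρ x) * √(1 + ‖sphGrad ρ x‖ ^ 2) + 1 := by
    refine (norm_sub_le _ _).trans ?_
    rw [norm_smul, hz, norm_sph, Real.norm_eq_abs, abs_of_pos (Real.exp_pos _)]
  have hk : 0 < 1 + (flowMap ρ 0 x).1 := by nlinarith
  rw [h3, norm_smul, norm_inv, Real.norm_eq_abs, abs_of_pos hk, inv_mul_eq_div,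
    div_le_div_iff₀ hk (by positivity)]
  nlinarith

theorem IsRealizable.tendsto_flowMap_fst (h : IsRealizable Ω ρ) {y : Sph n} (hy : y ∉ Ω) :
    Tendsto (fun x => (flowMap ρ 0 x).1) (𝓝[Ω] y) atTop := by
  have h1 := (h.tendsto_atTop hy).atTop_div_const (zero_lt_four' ℝ)
  refine tendsto_atTop_mono (fun x => ?_) h1
  rw [div_le_iff₀ (zero_lt_four' ℝ)]
  linarith [le_flowMap_fst ρ x]

theorem IsRealizable.contMDiffAt (h : IsRealizable Ω ρ) {x : Sph n} (hx : x ∈ Ω) :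
    ContMDiffAt (𝓡 n) 𝓘(ℝ, ℝ) ∞ ρ x := h.smooth.contMDiffAt (Ω.isOpen.mem_nhds hx)

theorem IsRealizable.tendsto_toBall_flowMap (h : IsRealizable Ω ρ) {y : Sph n} (hy : y ∉ Ω) :
    Tendsto (fun x => OrientedHypersurface.toBall (flowMap ρ 0 x)) (𝓝[Ω] y) (𝓝 (y : Euc n)) := by
  have h1 : Tendsto (fun x : Sph n => (x : Euc n)) (𝓝[Ω] y) (𝓝 (y : Euc n)) :=
    (continuous_subtype_val.tendsto y).mono_left nhdsWithin_le_nhds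
  have h2 : Tendsto (fun x => OrientedHypersurface.toBall (flowMap ρ 0 x) - (x : Euc n))
      (𝓝[Ω] y) (𝓝 0) := by
    refine squeeze_zero_norm' ?_ ((h.tendsto_atTop hy).const_div_atTop 7)
    filter_upwards [self_mem_nhdsWithin] with x hx
    exact norm_toBall_flowMap_sub_le (inner_sphGrad_self (h.contMDiffAt hx))
  simpa using h2.add h1

theorem norm_toBall_lt_one {X : Mink n} (hX : X ∈ Hyp n) :
    ‖OrientedHypersurface.toBall X‖ < 1 := by
  obtain ⟨h1, h2⟩ := hX
  rw [mink, real_inner_self_eq_norm_sq] at h1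
  have h3 : ‖X.2‖ < X.1 := by nlinarith [norm_nonneg X.2]
  rw [OrientedHypersurface.toBall, norm_smul, norm_inv, Real.norm_eq_abs,
    abs_of_pos (by linarith), inv_mul_lt_iff₀ (by linarith)]
  linarith

theorem continuousAt_flowMap {x : Sph n} (h : ContMDiffAt (𝓡 n) 𝓘(ℝ, ℝ) ∞ ρ x) :
    ContinuousAt (flowMap ρ 0) x := by
  have h1 : ContinuousAt (fun y : Sph n => flowExt ρ y) x :=
    ContinuousAt.comp (g := flowExt ρ) (contDiffAt_flowExt h).continuousAt
      continuous_subtype_val.continuousAt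
  simpa only [flowExt_coe] using h1

theorem continuousAt_toBall {X : Mink n} (hX : X ∈ Hyp n) :
    ContinuousAt OrientedHypersurface.toBall X := by
  unfold OrientedHypersurface.toBall
  have h : 1 + X.1 ≠ 0 := by linarith [hX.2]
  exact ((continuousAt_const.add continuousAt_fst).inv₀ h).smul continuousAt_snd

/-- An ultrafilter on an open set of the sphere has a limit in the sphere, either in the open set
or on its frontier. -/
theorem exists_ultrafilter_limit (𝒰 : Ultrafilter Ω) :
    (∃ x : Ω, (𝒰 : Filter Ω) ≤ 𝓝 x) ∨
      ∃ y ∈ frontier (Ω : Set (Sph n)), Tendsto (Subtype.val : Ω → Sph n) 𝒰 (𝓝[Ω] y) := by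
  obtain ⟨y, hy⟩ : ∃ y, ((𝒰.map Subtype.val : Ultrafilter (Sph n)) : Filter (Sph n)) ≤ 𝓝 y := by
    obtain ⟨y, -, hy⟩ := isCompact_univ.ultrafilter_le_nhds (𝒰.map (Subtype.val : Ω → Sph n))
      (by simp)
    exact ⟨y, hy⟩
  have hT : Tendsto (Subtype.val : Ω → Sph n) 𝒰 (𝓝 y) := hy
  have hT' : Tendsto (Subtype.val : Ω → Sph n) 𝒰 (𝓝[Ω] y) :=
    tendsto_nhdsWithin_iff.2 ⟨hT, Eventually.of_forall fun x => x.2⟩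
  by_cases hyΩ : y ∈ Ω
  · left
    refine ⟨⟨y, hyΩ⟩, ?_⟩
    rw [nhds_subtype_eq_comap]
    exact hT.le_comap
  · right
    refine ⟨y, ?_, hT'⟩
    rw [Ω.isOpen.frontier_eq]
    refine ⟨?_, hyΩ⟩
    rw [mem_closure_iff_nhdsWithin_neBot]
    exact hT'.neBot

/-- An ultrafilter on `Ω` converging to a frontier point sends the time coordinate to infinity, so
its image cannot converge; by compactness of the sphere, the only alternative is convergence in `Ω`.
-/
theorem IsRealizable.isProperMap_flowMap (h : IsRealizable Ω ρ) :
    IsProperMap (fun x : Ω => flowMap ρ 0 x) := by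
  rw [isProperMap_iff_ultrafilter]
  refine ⟨continuous_iff_continuousAt.2 fun x =>
    (continuousAt_flowMap (h.contMDiffAt x.2)).comp continuous_subtype_val.continuousAt, ?_⟩
  intro 𝒰 X hX
  rcases exists_ultrafilter_limit 𝒰 with ⟨x, hx⟩ | ⟨y, hy, hT⟩
  · refine ⟨x, ?_, hx⟩
    have h1 : ContinuousAt (fun x : Ω => flowMap ρ 0 x) x :=
      (continuousAt_flowMap (h.contMDiffAt x.2)).comp continuous_subtype_val.continuousAt
    exact tendsto_nhds_unique (h1.tendsto.mono_left hx) hX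
  · rw [Ω.isOpen.frontier_eq] at hy
    have h1 := (h.tendsto_flowMap_fst hy.2).comp hT
    have h2 := (continuous_fst.tendsto X).comp hX
    exact absurd h2 (not_tendsto_nhds_of_tendsto_atTop h1 _)

theorem IsRealizable.boundary_flowMap (h : IsRealizable Ω ρ) :
    {y : Sph n | (y : Euc n) ∈
      closure (range fun x : Ω => OrientedHypersurface.toBall (flowMap ρ 0 x))} =
      frontier (Ω : Set (Sph n)) := by
  ext y
  constructor
  · intro hy
    obtain ⟨𝒰, h𝒰⟩ : ∃ 𝒰 : Ultrafilter Ω,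
        Tendsto (fun x : Ω => OrientedHypersurface.toBall (flowMap ρ 0 x)) 𝒰 (𝓝 (y : Euc n)) := by
      have hne : NeBot (comap (fun x : Ω => OrientedHypersurface.toBall (flowMap ρ 0 x))
          (𝓝 (y : Euc n))) := by
        rw [comap_neBot_iff]
        intro s hs
        obtain ⟨z, hz, x, hx⟩ := mem_closure_iff_nhds.1 hy s hs
        exact ⟨x, by simpa [hx] using hz⟩
      exact ⟨Ultrafilter.of _, tendsto_comap.mono_left (Ultrafilter.of_le _)⟩
    -- A limit inside `Ω` would put the image limit in the open unit ball, whereas `y` has norm one.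
    -- At a frontier point `z` the image tends to `z` itself, so `y = z`.
    rcases exists_ultrafilter_limit 𝒰 with ⟨x, hx⟩ | ⟨z, hz, hT⟩
    · exfalso
      have hx1 := h.contMDiffAt x.2
      have h1 : ContinuousAt (fun x : Ω => OrientedHypersurface.toBall (flowMap ρ 0 x)) x :=
        ContinuousAt.comp (g := OrientedHypersurface.toBall)
          (continuousAt_toBall (flowMap_mem_hyp hx1))
          ((continuousAt_flowMap hx1).comp continuous_subtype_val.continuousAt)
      have h2 := tendsto_nhds_unique (h1.tendsto.mono_left hx) h𝒰
      have h3 := norm_toBall_lt_one (flowMap_mem_hyp hx1)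
      rw [h2, norm_sph] at h3
      exact lt_irrefl _ h3
    · have hz' := hz
      rw [Ω.isOpen.frontier_eq] at hz'
      have h1 := (h.tendsto_toBall_flowMap hz'.2).comp hT
      have h2 : y = z := Subtype.ext (tendsto_nhds_unique h𝒰 h1)
      rwa [h2]
  · intro hy
    rw [Ω.isOpen.frontier_eq] at hy
    have : NeBot (𝓝[Ω] y) := mem_closure_iff_nhdsWithin_neBot.1 hy.1
    refine mem_closure_of_tendsto (h.tendsto_toBall_flowMap hy.2) ?_
    filter_upwards [self_mem_nhdsWithin] with x hx
    exact ⟨⟨x, hx⟩, rfl⟩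

end Frontier

/-! ### Chain rule for maps extended to the ambient space. -/

section Ambient

variable {M : Type*} [TopologicalSpace M] [ChartedSpace (EuclideanSpace ℝ (Fin n)) M]

theorem mfderiv_ambient_comp {f : M → Sph n} {p : M} (hf : MDifferentiableAt (𝓡 n) (𝓡 n) f p)
    {Φ : Euc n → Mink n} (hΦ : DifferentiableAt ℝ Φ (f p)) {F : M → Mink n}
    (hF : ∀ q, F q = Φ (f q)) (v : TangentSpace (𝓡 n) p) :
    mfderiv (𝓡 n) 𝓘(ℝ, Mink n) F p v = fderiv ℝ Φ (f p) (sphDeriv f p v) := by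
  obtain rfl : F = fun q => Φ (f q) := funext hF
  have h1 : MDifferentiableAt (𝓡 n) 𝓘(ℝ, Euc n) (fun q => (f q : Euc n)) p :=
    MDifferentiableAt.comp p
      ((contMDiff_sphere_val (n := n) (f p)).mdifferentiableAt (by simp)) hf
  have h2 := mfderiv_comp p (g := Φ) (mdifferentiableAt_iff_differentiableAt.2 hΦ) h1
  have h3 := congrArg (fun l => l v) h2
  rw [mfderiv_eq_fderiv] at h3
  exact h3

theorem contMDiffAt_ambient_comp {f : M → Sph n} {p : M} (hf : ContMDiffAt (𝓡 n) (𝓡 n) ∞ f p)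
    {Φ : Euc n → Mink n} (hΦ : ContDiffAt ℝ ∞ Φ (f p)) :
    ContMDiffAt (𝓡 n) 𝓘(ℝ, Mink n) ∞ (fun q => Φ (f q)) p :=
  ContMDiffAt.comp (g := Φ) (f := fun q => (f q : Euc n)) p hΦ.contMDiffAt
    (ContMDiffAt.comp p (contMDiff_sphere_val (f p)) hf)

end Ambient

/-! ### Adding a constant to `ρ`. -/

section AddConst

variable {ρ : Sph n → ℝ}

theorem radialExt_add_const (ρ : Sph n → ℝ) (t : ℝ) {y : Euc n} (hy : y ≠ 0) :
    radialExt (fun x => ρ x + t) y = radialExt ρ y + t := by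
  rw [radialExt_apply _ hy, radialExt_apply _ hy]

theorem radialExt_add_const_eventuallyEq (ρ : Sph n → ℝ) (t : ℝ) (x : Sph n) :
    radialExt (fun x => ρ x + t) =ᶠ[𝓝 (x : Euc n)] fun y => radialExt ρ y + t := by
  filter_upwards [isOpen_ne.mem_nhds (sph_ne_zero x)] with y hy using radialExt_add_const ρ t hy

theorem sphGrad_add_const (ρ : Sph n → ℝ) (t : ℝ) (x : Sph n) :
    sphGrad (fun x => ρ x + t) x = sphGrad ρ x := by
  rw [sphGrad, sphGrad, gradient, gradient, (radialExt_add_const_eventuallyEq ρ t x).fderiv_eq,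
    fderiv_add_const]

theorem tensorP_add_const (ρ : Sph n → ℝ) (t : ℝ) (x : Sph n) (u v : Euc n) :
    tensorP (fun x => ρ x + t) x u v = tensorP ρ x u v := by
  have h : fderiv ℝ (fun y => radialExt ρ y + t) = fderiv ℝ (radialExt ρ) := by
    ext1 y
    exact fderiv_add_const t
  rw [tensorP, tensorP, sphGrad_add_const, sphHess, sphHess,
    (radialExt_add_const_eventuallyEq ρ t x).fderiv.fderiv_eq, h]

theorem flowMap_add_const (ρ : Sph n → ℝ) (t : ℝ) (x : Sph n) :
    flowMap (fun x => ρ x + t) 0 x = flowMap ρ t x := by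
  simp only [flowMap, sphGrad_add_const, add_zero]

variable {Ω : TopologicalSpace.Opens (Sph n)}

/-- `P` depends only on derivatives of `ρ`, while the metric against which it is measured grows by
`exp (2t)`. The constant `C` does not depend on `t`. -/
theorem IsRealizable.tensorP_add_const_le (h : IsRealizable Ω ρ) : ∃ C : ℝ, 0 ≤ C ∧ ∀ t, ∀ x ∈ Ω,
    ∀ u v : Euc n, ⟪(x : Euc n), u⟫ = 0 → ⟪(x : Euc n), v⟫ = 0 →
      |tensorP (fun x => ρ x + t) x u v| ≤
        C * Real.exp (-2 * t) * Real.exp (2 * (ρ x + t)) * ‖u‖ * ‖v‖ := by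
  obtain ⟨C, hC⟩ := h.bounded
  refine ⟨|C|, abs_nonneg C, fun t x hx u v hu hv => ?_⟩
  rw [tensorP_add_const, mul_assoc |C|, ← Real.exp_add]
  refine (hC x hx u v hu hv).trans ?_
  rw [show -2 * t + 2 * (ρ x + t) = 2 * ρ x by ring]
  gcongr
  exact le_abs_self C

theorem IsRealizable.add_const (h : IsRealizable Ω ρ) (t : ℝ) :
    IsRealizable Ω (fun x => ρ x + t) where
  smooth := h.smooth.add contMDiffOn_const
  complete := by
    refine h.complete.of_map (F := id) (g := id) conformalNorm_smul contMDiff_id continuous_id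
      (fun _ => rfl) (Real.exp_pos (-t)) fun p v => ?_
    rw [mfderiv_id]
    refine le_of_eq ?_
    change Real.exp (ρ p) * _ = Real.exp (-t) * (Real.exp (ρ p + t) * _)
    rw [← mul_assoc, ← Real.exp_add]
    ring_nf
    rfl
  bounded := by
    obtain ⟨C, -, hC⟩ := h.tensorP_add_const_le
    exact ⟨_, hC t⟩

end AddConst

/-! ### From a conformal metric to a hypersurface. -/

section Hypersurface

variable {Ω : TopologicalSpace.Opens (Sph n)} {ρ : Sph n → ℝ}

theorem quarter_le_inner_halfSubP {x : Sph n} (hρ : ContMDiffAt (𝓡 n) 𝓘(ℝ, ℝ) ∞ ρ x) {u : Euc n}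
    (hu : ⟪(x : Euc n), u⟫ = 0)
    (hP : |tensorP ρ x u u| ≤ 1 / 4 * Real.exp (2 * ρ x) * ‖u‖ * ‖u‖) :
    1 / 4 * ‖u‖ ^ 2 ≤ ⟪halfSubP ρ x u, u⟫ ∧ ⟪halfSubP ρ x u, u⟫ ≤ 3 / 4 * ‖u‖ ^ 2 := by
  rw [inner_halfSubP hρ u hu, real_inner_self_eq_norm_sq]
  have h1 : |Real.exp (-2 * ρ x) * tensorP ρ x u u| ≤ 1 / 4 * ‖u‖ ^ 2 := by
    rw [abs_mul, abs_of_pos (Real.exp_pos _)]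
    calc _ ≤ Real.exp (-2 * ρ x) * (1 / 4 * Real.exp (2 * ρ x) * ‖u‖ * ‖u‖) := by gcongr
      _ = 1 / 4 * ‖u‖ ^ 2 := by
        rw [show -2 * ρ x = -(2 * ρ x) by ring, Real.exp_neg]
        field_simp
  rw [abs_le] at h1
  constructor <;> linarith

/-- Coercivity together with Cauchy–Schwarz. This gives both that `φ` is an immersion and that its
induced metric dominates a multiple of `exp (2ρ) g`. -/
theorem norm_le_norm_halfSubP {x : Sph n} (hρ : ContMDiffAt (𝓡 n) 𝓘(ℝ, ℝ) ∞ ρ x) {u : Euc n}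
    (hu : ⟪(x : Euc n), u⟫ = 0)
    (hP : |tensorP ρ x u u| ≤ 1 / 4 * Real.exp (2 * ρ x) * ‖u‖ * ‖u‖) :
    ‖u‖ ≤ 4 * ‖halfSubP ρ x u‖ := by
  have h1 := (quarter_le_inner_halfSubP hρ hu hP).1.trans (real_inner_le_norm _ _)
  rcases (norm_nonneg u).eq_or_lt with h0 | h0
  · rw [← h0]; positivity
  · nlinarith

theorem mfderiv_flowMap {M : Type*} [TopologicalSpace M]
    [ChartedSpace (EuclideanSpace ℝ (Fin n)) M] {f : M → Sph n} {p : M}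
    (hf : MDifferentiableAt (𝓡 n) (𝓡 n) f p) (hρ : ContMDiffAt (𝓡 n) 𝓘(ℝ, ℝ) ∞ ρ (f p))
    (v : TangentSpace (𝓡 n) p) :
    mfderiv (𝓡 n) 𝓘(ℝ, Mink n) (fun q => flowMap ρ 0 (f q)) p v =
      coneDeriv ρ (f p) (halfSubP ρ (f p) (sphDeriv f p v)) := by
  rw [← fderiv_flowExt hρ]
  exact mfderiv_ambient_comp hf ((contDiffAt_flowExt hρ).differentiableAt (by simp))
    (fun q => (flowExt_coe ρ (f q)).symm) v

theorem mfderiv_cone {M : Type*} [TopologicalSpace M]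
    [ChartedSpace (EuclideanSpace ℝ (Fin n)) M] {f : M → Sph n} {p : M}
    (hf : MDifferentiableAt (𝓡 n) (𝓡 n) f p) (hρ : ContMDiffAt (𝓡 n) 𝓘(ℝ, ℝ) ∞ ρ (f p))
    (v : TangentSpace (𝓡 n) p) :
    mfderiv (𝓡 n) 𝓘(ℝ, Mink n) (fun q => Real.exp (ρ (f q)) • nullVec (f q)) p v =
      coneDeriv ρ (f p) (sphDeriv f p v) := by
  rw [← fderiv_coneExt hρ]
  exact mfderiv_ambient_comp hf ((contDiffAt_coneExt hρ).differentiableAt (by simp))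
    (fun q => (coneExt_coe ρ (f q)).symm) v

theorem mfderiv_normal {M : Type*} [TopologicalSpace M]
    [ChartedSpace (EuclideanSpace ℝ (Fin n)) M] {f : M → Sph n} {p : M}
    (hf : MDifferentiableAt (𝓡 n) (𝓡 n) f p) (hρ : ContMDiffAt (𝓡 n) 𝓘(ℝ, ℝ) ∞ ρ (f p))
    (v : TangentSpace (𝓡 n) p) :
    mfderiv (𝓡 n) 𝓘(ℝ, Mink n)
        (fun q => flowMap ρ 0 (f q) - Real.exp (ρ (f q)) • nullVec (f q)) p v =
      coneDeriv ρ (f p) (halfSubP ρ (f p) (sphDeriv f p v)) -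
        coneDeriv ρ (f p) (sphDeriv f p v) := by
  have h1 := (contDiffAt_flowExt hρ).differentiableAt (by simp)
  have h2 := (contDiffAt_coneExt hρ).differentiableAt (by simp)
  have h3 : fderiv ℝ (flowExt ρ - coneExt ρ) (f p) (sphDeriv f p v) =
      coneDeriv ρ (f p) (halfSubP ρ (f p) (sphDeriv f p v)) -
        coneDeriv ρ (f p) (sphDeriv f p v) := by
    rw [fderiv_sub h1 h2, ← fderiv_flowExt hρ, ← fderiv_coneExt hρ]
    rfl
  rw [← h3]
  exact mfderiv_ambient_comp hf (h1.sub h2)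
    (fun q => by rw [Pi.sub_apply, flowExt_coe, coneExt_coe]) v

theorem mink_sub_left (X Y Z : Mink n) : mink (X - Y) Z = mink X Z - mink Y Z := by
  simp only [mink, Prod.fst_sub, Prod.snd_sub, inner_sub_left]; ring

theorem mink_smul_left (r : ℝ) (X Y : Mink n) : mink (r • X) Y = r * mink X Y := by
  simp only [mink, Prod.smul_fst, Prod.smul_snd, real_inner_smul_left, smul_eq_mul]; ring

theorem mink_comm (X Y : Mink n) : mink X Y = mink Y X := by
  simp only [mink, real_inner_comm X.2 Y.2, mul_comm X.1 Y.1]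

theorem mink_sub_smul_self (X Y : Mink n) (r : ℝ) :
    mink (X - r • Y) (X - r • Y) = mink X X - 2 * r * mink X Y + r ^ 2 * mink Y Y := by
  rw [mink_sub_left, mink_smul_left, mink_comm X (X - r • Y), mink_comm Y (X - r • Y),
    mink_sub_left, mink_sub_left, mink_smul_left, mink_smul_left, mink_comm Y X]
  ring

theorem mink_nullVec_self (x : Sph n) : mink (nullVec x) (nullVec x) = 0 := by
  simp [mink, nullVec]

/-- The hypersurface `flowMap ρ 0` over an open set on which `P` is small. -/
def flowHypersurface (Ω : TopologicalSpace.Opens (Sph n)) (ρ : Sph n → ℝ)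
    (hρ : ∀ x ∈ Ω, ContMDiffAt (𝓡 n) 𝓘(ℝ, ℝ) ∞ ρ x)
    (hP : ∀ x ∈ Ω, ∀ u : Euc n, ⟪(x : Euc n), u⟫ = 0 →
      |tensorP ρ x u u| ≤ 1 / 4 * Real.exp (2 * ρ x) * ‖u‖ * ‖u‖) :
    OrientedHypersurface n Ω where
  φ x := flowMap ρ 0 x
  η x := flowMap ρ 0 x - Real.exp (ρ x) • nullVec (x : Sph n)
  smooth_φ x := by
    simp only [← flowExt_coe]
    exact contMDiffAt_ambient_comp (contMDiff_opens_val Ω x) (contDiffAt_flowExt (hρ x x.2))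
  smooth_η x := by
    simp only [← flowExt_coe, ← coneExt_coe]
    exact contMDiffAt_ambient_comp (Φ := fun y => flowExt ρ y - coneExt ρ y)
      (contMDiff_opens_val Ω x) ((contDiffAt_flowExt (hρ x x.2)).sub (contDiffAt_coneExt (hρ x x.2)))
  mem_hyp x := flowMap_mem_hyp (hρ x x.2)
  immersion x := by
    have hd : MDifferentiableAt (𝓡 n) (𝓡 n) (Subtype.val : Ω → Sph n) x :=
      (contMDiff_opens_val Ω x).mdifferentiableAt (by simp)
    refine (injective_iff_map_eq_zero _).2 fun v hv => ?_
    rw [mfderiv_flowMap hd (hρ x x.2)] at hv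
    have hu := inner_sphDeriv hd v
    have h1 := inner_self_halfSubP (hρ x x.2) hu
    have h2 : mink (coneDeriv ρ x (halfSubP ρ x (sphDeriv (Subtype.val : Ω → Sph n) x v)))
      (coneDeriv ρ x (halfSubP ρ x (sphDeriv (Subtype.val : Ω → Sph n) x v))) = 0 := by
      rw [hv]
      exact (by simp [mink] : mink (0 : Mink n) 0 = 0)
    rw [mink_coneDeriv h1 h1, mul_eq_zero, or_iff_right (Real.exp_pos _).ne',
      inner_self_eq_zero] at h2
    have h3 := norm_le_norm_halfSubP (hρ x x.2) hu (hP x x.2 _ hu)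
    rw [h2, norm_zero, mul_zero] at h3
    have h4 := norm_le_zero_iff.1 h3
    exact sphDeriv_injective hd (mfderiv_opens_val_injective Ω x) (h4.trans (map_zero _).symm)
  unit_η x := by
    have h1 := (flowMap_mem_hyp (hρ x x.2)).1
    have h2 := mink_flowMap_nullVec (hρ x x.2)
    have h3 := mink_nullVec_self (x : Sph n)
    rw [mink_sub_smul_self, h1, h2, h3, Real.exp_neg]
    have := (Real.exp_pos (ρ x)).ne'
    field_simp
    ring
  tangent_η x := by
    have h1 := (flowMap_mem_hyp (hρ x x.2)).1
    have h2 := mink_flowMap_nullVec (hρ x x.2)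
    simp only [mink_sub_left, mink_smul_left, mink_comm (nullVec _) (flowMap _ _ _), h1, h2,
      Real.exp_neg]
    have := (Real.exp_pos (ρ x)).ne'
    field_simp
    ring
  normal_η x v := by
    have hd : MDifferentiableAt (𝓡 n) (𝓡 n) (Subtype.val : Ω → Sph n) x :=
      (contMDiff_opens_val Ω x).mdifferentiableAt (by simp)
    rw [mfderiv_flowMap hd (hρ x x.2)]
    have h1 := inner_self_halfSubP (hρ x x.2) (inner_sphDeriv hd v)
    rw [mink_sub_left, mink_smul_left, mink_flowMap_coneDeriv (hρ x x.2) h1,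
      mink_nullVec_coneDeriv h1]
    ring

/-- The hypersurface of a complete metric with small `P` is admissible. -/
theorem IsRealizable.exists_hypersurface (h : IsRealizable Ω ρ)
    (hP : ∀ x ∈ Ω, ∀ u : Euc n, ⟪(x : Euc n), u⟫ = 0 →
      |tensorP ρ x u u| ≤ 1 / 4 * Real.exp (2 * ρ x) * ‖u‖ * ‖u‖) :
    ∃ S : OrientedHypersurface n Ω, (∀ x : Ω, S.φ x = flowMap ρ 0 x) ∧
      (∀ x : Ω, S.gauss x = x ∧ S.support x = ρ x) ∧ S.IsAdmissible ∧
      S.boundaryAtInfinity = frontier (Ω : Set (Sph n)) := by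
  have hρ : ∀ x ∈ Ω, ContMDiffAt (𝓡 n) 𝓘(ℝ, ℝ) ∞ ρ x := fun x hx => h.contMDiffAt hx
  set S := flowHypersurface Ω ρ hρ hP with hS
  have hd : ∀ x : Ω, MDifferentiableAt (𝓡 n) (𝓡 n) (Subtype.val : Ω → Sph n) x := fun x =>
    (contMDiff_opens_val Ω x).mdifferentiableAt (by simp)
  have hdφ : ∀ (x : Ω) (v : TangentSpace (𝓡 n) x), mfderiv (𝓡 n) 𝓘(ℝ, Mink n) S.φ x v =
      coneDeriv ρ x (halfSubP ρ x (sphDeriv (Subtype.val : Ω → Sph n) x v)) :=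
    fun x v => mfderiv_flowMap (hd x) (hρ x x.2) v
  have hψ : ∀ x, S.ψ x = Real.exp (ρ x) • nullVec (x : Sph n) := fun x => by
    rw [OrientedHypersurface.ψ]
    exact sub_sub_cancel _ _
  have hψ1 : ∀ x, (S.ψ x).1 = Real.exp (ρ x) := fun x => by rw [hψ]; simp [nullVec]
  have hgauss : ∀ x : Ω, S.gauss x = x := fun x => by
    ext1
    change (S.ψ x).1⁻¹ • (S.ψ x).2 = _
    rw [hψ1, hψ]
    simp [nullVec, smul_smul]
  refine ⟨S, fun x => rfl, fun x => ⟨hgauss x, ?_⟩, ⟨h.isProperMap_flowMap, ?_, ?_, ?_⟩,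
    h.boundary_flowMap⟩
  · rw [OrientedHypersurface.support, hψ1, Real.log_exp]
  · refine h.complete.of_map (F := id) (g := id) conformalNorm_smul contMDiff_id continuous_id
      (fun _ => rfl) (zero_lt_four' ℝ) fun x v => ?_
    have hu := inner_sphDeriv (hd x) v
    have h1 := inner_self_halfSubP (hρ x x.2) hu
    rw [mfderiv_id]
    have h2 : S.inducedNorm x v = Real.exp (ρ x) *
        ‖halfSubP ρ x (sphDeriv (Subtype.val : Ω → Sph n) x v)‖ := by
      rw [OrientedHypersurface.inducedNorm, hdφ x v, mink_coneDeriv h1 h1,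
        real_inner_self_eq_norm_sq, Real.sqrt_eq_iff_mul_self_eq (by positivity) (by positivity),
        two_mul, Real.exp_add]
      ring
    have h3 : conformalNorm Ω ρ x v =
      Real.exp (ρ x) * ‖sphDeriv (Subtype.val : Ω → Sph n) x v‖ := rfl
    change conformalNorm Ω ρ x v ≤ _
    rw [h2, h3, mul_left_comm]
    exact mul_le_mul_of_nonneg_left (norm_le_norm_halfSubP (hρ x x.2) hu (hP x x.2 _ hu))
      (Real.exp_pos _).le
  -- Pairing `dη v = -κ dφ v` with `dψ v` gives `(1 + κ) ⟪Q u, u⟫ = |u|²`. As `0 < ⟪Q u, u⟫ ≤ 3/4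
  -- |u|²`, this forces `κ ≥ 1/3`, so `0` is a safe lower bound.
  · refine ⟨0, by norm_num, fun x κ ⟨v, hv0, hv⟩ => ?_⟩
    have hu := inner_sphDeriv (hd x) v
    have h1 := inner_self_halfSubP (hρ x x.2) hu
    have hdη : mfderiv (𝓡 n) 𝓘(ℝ, Mink n) S.η x v =
      coneDeriv ρ x (halfSubP ρ x (sphDeriv (Subtype.val : Ω → Sph n) x v)) -
        coneDeriv ρ x (sphDeriv (Subtype.val : Ω → Sph n) x v) :=
      mfderiv_normal (hd x) (hρ x x.2) v
    rw [hdη, hdφ x v] at hv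
    have hu0 : 0 < ‖sphDeriv (Subtype.val : Ω → Sph n) x v‖ := by
      rw [norm_pos_iff]
      intro h0
      exact hv0 (sphDeriv_injective (hd x) (mfderiv_opens_val_injective Ω x)
        (h0.trans (map_zero _).symm))
    have hq := quarter_le_inner_halfSubP (hρ x x.2) hu (hP x x.2 _ hu)
    generalize sphDeriv (Subtype.val : Ω → Sph n) x v = u at *
    have h2 : mink (coneDeriv ρ x (halfSubP ρ x u) - coneDeriv ρ x u) (coneDeriv ρ x u) =
        mink ((-κ) • coneDeriv ρ x (halfSubP ρ x u)) (coneDeriv ρ x u) := by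
      rw [neg_smul]
      exact congrArg (fun X => mink X (coneDeriv ρ x u)) hv
    rw [mink_sub_left, mink_smul_left, mink_coneDeriv h1 hu, mink_coneDeriv hu hu,
      real_inner_self_eq_norm_sq] at h2
    have h3 : (1 + κ) * ⟪halfSubP ρ x u, u⟫ = ‖u‖ ^ 2 := by
      have hE := (Real.exp_pos (2 * ρ x)).ne'
      refine mul_left_cancel₀ hE ?_
      linarith
    by_contra hκ
    nlinarith [sq_pos_of_pos hu0]
  · intro x y hxy
    rw [hgauss, hgauss] at hxy
    exact Subtype.ext hxy

theorem IsRealizable.exists_forall_hypersurface (h : IsRealizable Ω ρ) :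
    ∃ t₀ : ℝ, ∀ t ≥ t₀, ∃ S : OrientedHypersurface n Ω, (∀ x : Ω, S.φ x = flowMap ρ t x) ∧
      (∀ x : Ω, S.gauss x = x ∧ S.support x = ρ x + t) ∧ S.IsAdmissible ∧
      S.boundaryAtInfinity = frontier (Ω : Set (Sph n)) := by
  obtain ⟨C, hC0, hC⟩ := h.tensorP_add_const_le
  -- Chosen to make `C * exp (-2t) ≤ 1/4`; the `+ 1` keeps the logarithm meaningful when `C = 0`.
  refine ⟨Real.log (4 * C + 1) / 2, fun t ht => ?_⟩
  have h1 : C * Real.exp (-2 * t) ≤ 1 / 4 := by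
    have h2 : 4 * C + 1 ≤ Real.exp (2 * t) := by
      rw [← Real.log_le_iff_le_exp (by positivity)]
      linarith
    rw [neg_mul, Real.exp_neg, ← div_eq_mul_inv, div_le_iff₀ (Real.exp_pos _)]
    linarith
  obtain ⟨S, hS1, hS2, hS3⟩ := (h.add_const t).exists_hypersurface fun x hx u hu =>
    (hC t x hx u u hu hu).trans (by gcongr)
  exact ⟨S, fun x => (hS1 x).trans (flowMap_add_const ρ t x), hS2, hS3⟩

end Hypersurface

/-! ### Norm of a symmetric operator from its eigenvalues. -/

section Spectral

variable {W : Type*} [NormedAddCommGroup W] [InnerProductSpace ℝ W] [FiniteDimensional ℝ W]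

/-- A symmetric operator all of whose eigenvalues are bounded by `c` is bounded by `c`. -/
theorem norm_le_of_eigenvalues_le {T : W →ₗ[ℝ] W} (hT : T.IsSymmetric) {c : ℝ} (hc : 0 ≤ c)
    (h : ∀ (s : ℝ) (w : W), w ≠ 0 → T w = s • w → |s| ≤ c) (w : W) : ‖T w‖ ≤ c * ‖w‖ := by
  set b := hT.eigenvectorBasis rfl with hb
  have hev : ∀ i, |hT.eigenvalues rfl i| ≤ c := fun i =>
    h _ (b i) (b.orthonormal.ne_zero i) (hT.apply_eigenvectorBasis rfl i)
  rw [← b.repr.norm_map (T w), ← b.repr.norm_map w]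
  refine le_of_sq_le_sq ?_ (by positivity)
  rw [mul_pow, EuclideanSpace.norm_sq_eq, EuclideanSpace.norm_sq_eq, Finset.mul_sum]
  refine Finset.sum_le_sum fun i _ => ?_
  rw [hb, hT.eigenvectorBasis_apply_self_apply, norm_mul, mul_pow]
  gcongr
  exact hev i

end Spectral

/-! ### Derivatives read in a chart. -/

section Chart

variable {M : Type*} [TopologicalSpace M] [ChartedSpace (EuclideanSpace ℝ (Fin n)) M]
  {F : Type*} [NormedAddCommGroup F] [NormedSpace ℝ F]

theorem hasFDerivAt_chart {f : M → F} {p : M} (hf : MDifferentiableAt (𝓡 n) 𝓘(ℝ, F) f p) :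
    HasFDerivAt (fun z => f ((extChartAt (𝓡 n) p).symm z))
      (mfderiv (𝓡 n) 𝓘(ℝ, F) f p : EuclideanSpace ℝ (Fin n) →L[ℝ] F) (extChartAt (𝓡 n) p p) := by
  have h := hf.hasMFDerivAt.2
  rw [modelWithCornersSelf_coe, range_id] at h
  exact hasFDerivWithinAt_univ.1 h

theorem extChartAt_symm_self (p : M) : (extChartAt (𝓡 n) p).symm (extChartAt (𝓡 n) p p) = p :=
  extChartAt_to_inv p

end Chart

theorem hasFDerivAt_unique_apply {E F : Type*} [NormedAddCommGroup E] [NormedSpace ℝ E]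
    [NormedAddCommGroup F] [NormedSpace ℝ F] {f : E → F} {f₁ f₂ : E →L[ℝ] F} {x : E}
    (h₁ : HasFDerivAt f f₁ x) (h₂ : HasFDerivAt f f₂ x) (v : E) : f₁ v = f₂ v := by
  rw [h₁.unique h₂]

section MinkDeriv

variable {E : Type*} [NormedAddCommGroup E] [NormedSpace ℝ E]

theorem hasFDerivAt_mink_apply {f g : E → Mink n} {f' g' : E →L[ℝ] Mink n} {z : E}
    (hf : HasFDerivAt f f' z) (hg : HasFDerivAt g g' z) (v : E) {k : ℝ}
    (hk : ∀ y, mink (f y) (g y) = k) : mink (f' v) (g z) + mink (f z) (g' v) = 0 := by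
  have h1 := (hf.fst.mul hg.fst).neg.add (hf.snd.inner ℝ hg.snd)
  have h2 : HasFDerivAt (fun y => mink (f y) (g y)) (0 : E →L[ℝ] ℝ) z := by
    simp only [hk]
    exact hasFDerivAt_const k z
  have h3 := congrArg (fun l => l v) (h1.unique h2)
  simp at h3
  simp only [mink]
  linarith

end MinkDeriv

/-! ### From a hypersurface to a conformal metric. -/

namespace OrientedHypersurface

variable {M : Type*} [TopologicalSpace M] [ChartedSpace (EuclideanSpace ℝ (Fin n)) M]
  (S : OrientedHypersurface n M)

theorem mdifferentiableAt_φ (p : M) : MDifferentiableAt (𝓡 n) 𝓘(ℝ, Mink n) S.φ p :=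
  (S.smooth_φ p).mdifferentiableAt (by simp)

theorem mdifferentiableAt_η (p : M) : MDifferentiableAt (𝓡 n) 𝓘(ℝ, Mink n) S.η p :=
  (S.smooth_η p).mdifferentiableAt (by simp)

theorem smooth_ψ : ContMDiff (𝓡 n) 𝓘(ℝ, Mink n) ∞ S.ψ := S.smooth_φ.sub S.smooth_η

theorem mdifferentiableAt_ψ (p : M) : MDifferentiableAt (𝓡 n) 𝓘(ℝ, Mink n) S.ψ p :=
  (S.smooth_ψ p).mdifferentiableAt (by simp)

/-- The differential of `φ`, with values in Minkowski space. -/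
def dφ (p : M) : TangentSpace (𝓡 n) p →L[ℝ] Mink n := mfderiv (𝓡 n) 𝓘(ℝ, Mink n) S.φ p

/-- The differential of `η`, with values in Minkowski space. -/
def dη (p : M) : TangentSpace (𝓡 n) p →L[ℝ] Mink n := mfderiv (𝓡 n) 𝓘(ℝ, Mink n) S.η p

/-- The differential of `ψ`, with values in Minkowski space. -/
def dψ (p : M) : TangentSpace (𝓡 n) p →L[ℝ] Mink n := mfderiv (𝓡 n) 𝓘(ℝ, Mink n) S.ψ p

theorem dψ_eq (p : M) (v : TangentSpace (𝓡 n) p) : S.dψ p v = S.dφ p v - S.dη p v := by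
  have h := (hasFDerivAt_chart (S.mdifferentiableAt_φ p)).sub
    (hasFDerivAt_chart (S.mdifferentiableAt_η p))
  exact hasFDerivAt_unique_apply (E := EuclideanSpace ℝ (Fin n))
    (hasFDerivAt_chart (S.mdifferentiableAt_ψ p)) h v

theorem mink_φ_dφ (p : M) (v : TangentSpace (𝓡 n) p) : mink (S.φ p) (S.dφ p v) = 0 := by
  have h := hasFDerivAt_chart (S.mdifferentiableAt_φ p)
  have h1 := hasFDerivAt_mink_apply h h v (k := -1) fun y => (S.mem_hyp _).1
  rw [extChartAt_symm_self, mink_comm _ (S.φ p)] at h1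
  change mink (S.φ p) (S.dφ p v) + mink (S.φ p) (S.dφ p v) = 0 at h1
  linarith

theorem mink_φ_dη (p : M) (v : TangentSpace (𝓡 n) p) : mink (S.φ p) (S.dη p v) = 0 := by
  have h1 := hasFDerivAt_mink_apply (hasFDerivAt_chart (S.mdifferentiableAt_η p))
    (hasFDerivAt_chart (S.mdifferentiableAt_φ p)) v (k := 0) fun y => S.tangent_η _
  rw [extChartAt_symm_self] at h1
  change mink (S.dη p v) (S.φ p) + mink (S.η p) (S.dφ p v) = 0 at h1
  have h2 : mink (S.η p) (S.dφ p v) = 0 := S.normal_η p v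
  rw [mink_comm]
  linarith

theorem mink_φ_dψ (p : M) (v : TangentSpace (𝓡 n) p) : mink (S.φ p) (S.dψ p v) = 0 := by
  rw [dψ_eq, mink_comm, mink_sub_left, mink_comm, mink_φ_dφ, mink_comm, mink_φ_dη, sub_zero]

theorem mink_φ_ψ (p : M) : mink (S.φ p) (S.ψ p) = -1 := by
  rw [ψ, mink_comm, mink_sub_left, (S.mem_hyp p).1, S.tangent_η]
  norm_num

theorem smooth_gauss [IsManifold (𝓡 n) ∞ M] : ContMDiff (𝓡 n) (𝓡 n) ∞ S.gauss := by
  have h : ContMDiff (𝓡 n) 𝓘(ℝ, Euc n) ∞ (fun p => (S.ψ p).1⁻¹ • (S.ψ p).2) := by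
    intro p
    have h1 : ContDiffAt ℝ ∞ (fun X : Mink n => X.1⁻¹ • X.2) (S.ψ p) :=
      (contDiffAt_fst.inv (S.ψ_pos p).ne').smul contDiffAt_snd
    exact ContMDiffAt.comp (g := fun X : Mink n => X.1⁻¹ • X.2) p h1.contMDiffAt (S.smooth_ψ p)
  exact ContMDiff.codRestrict_sphere h fun p => (S.gauss p).2

theorem smooth_support : ContMDiff (𝓡 n) 𝓘(ℝ, ℝ) ∞ S.support := by
  intro p
  have h1 : ContDiffAt ℝ ∞ (fun X : Mink n => Real.log X.1) (S.ψ p) :=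
    contDiffAt_fst.log (S.ψ_pos p).ne'
  exact ContMDiffAt.comp (g := fun X : Mink n => Real.log X.1) p h1.contMDiffAt (S.smooth_ψ p)

theorem mdifferentiableAt_gauss [IsManifold (𝓡 n) ∞ M] (p : M) : MDifferentiableAt (𝓡 n) (𝓡 n) S.gauss p :=
  (S.smooth_gauss p).mdifferentiableAt (by simp)

theorem inducedNorm_smul (p : M) (r : ℝ) (v : TangentSpace (𝓡 n) p) :
    S.inducedNorm p (r • v) = |r| * S.inducedNorm p v := by
  have h : S.dφ p (r • v) = r • S.dφ p v := map_smul _ r _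
  change √(mink (S.dφ p (r • v)) (S.dφ p (r • v))) =
    |r| * √(mink (S.dφ p v) (S.dφ p v))
  rw [h, mink_smul_left, mink_comm, mink_smul_left, ← mul_assoc, ← sq,
    Real.sqrt_mul (sq_nonneg r), Real.sqrt_sq_eq_abs]

variable {S}

/-- A nonzero vector in the kernel of `dψ = dφ - dη` would be a principal direction with curvature
`-1`. -/
theorem IsUniformlyWeaklyHorosphericallyConvex.dψ_eq_zero
    (h : S.IsUniformlyWeaklyHorosphericallyConvex) {p : M} {v : TangentSpace (𝓡 n) p}
    (hv : S.dψ p v = 0) : v = 0 := by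
  by_contra hv0
  obtain ⟨κ₀, hκ₀, hκ⟩ := h
  refine absurd (hκ p (-1) ⟨v, hv0, ?_⟩) (not_le.2 hκ₀)
  have h1 : S.dη p v = -((-1 : ℝ) • S.dφ p v) := by
    rw [dψ_eq] at hv
    rw [neg_smul, one_smul, neg_neg]
    exact (sub_eq_zero.1 hv).symm
  exact h1

variable [IsManifold (𝓡 n) ∞ M]

/-- If `dG v = 0`, then `dψ v` is a multiple of `(1, G)`. But `⟨φ, dψ v⟩ = 0` and `⟨φ, ψ⟩ = -1`, so
the multiple vanishes and `dψ v = 0`. -/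
theorem IsUniformlyWeaklyHorosphericallyConvex.mfderiv_gauss_injective
    (h : S.IsUniformlyWeaklyHorosphericallyConvex) (p : M) :
    Function.Injective (mfderiv (𝓡 n) (𝓡 n) S.gauss p) := by
  refine (injective_iff_map_eq_zero _).2 fun v hv => h.dψ_eq_zero (p := p) ?_
  have hG : sphDeriv S.gauss p v = 0 := by
    rw [sphDeriv_eq (S.mdifferentiableAt_gauss p), hv]
    exact map_zero _
  have hGd : MDifferentiableAt (𝓡 n) 𝓘(ℝ, Euc n) (fun q => (S.gauss q : Euc n)) p :=
    (contMDiff_sphere_val.comp S.smooth_gauss p).mdifferentiableAt (by simp)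
  have hψ := hasFDerivAt_chart (S.mdifferentiableAt_ψ p)
  have h1 := hψ.fst.smul (hasFDerivAt_chart hGd)
  have h2 : HasFDerivAt
      (fun z => (S.ψ ((extChartAt (𝓡 n) p).symm z)).1 •
        (S.gauss ((extChartAt (𝓡 n) p).symm z) : Euc n))
      ((ContinuousLinearMap.snd ℝ ℝ (Euc n)).comp (S.dψ p)) (extChartAt (𝓡 n) p p) := by
    refine hψ.snd.congr_of_eventuallyEq (Eventually.of_forall fun z => ?_)
    have h0 := (S.ψ_pos ((extChartAt (𝓡 n) p).symm z)).ne'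
    simp only [gauss, smul_smul, mul_inv_cancel₀ h0, one_smul]
  have h3 := hasFDerivAt_unique_apply (E := EuclideanSpace ℝ (Fin n)) h2 h1 v
  have h4 : (S.dψ p v).2 = (S.ψ p).1 • sphDeriv S.gauss p v +
      (S.dψ p v).1 • (S.gauss p : Euc n) := by
    refine h3.trans ?_
    simp only [extChartAt_symm_self]
    rfl
  rw [hG, smul_zero, zero_add] at h4
  have h5 : S.dψ p v = (S.dψ p v).1 • nullVec (S.gauss p) := by
    ext1
    · simp [nullVec]
    · rw [h4]; simp [nullVec]
  have h6 := S.mink_φ_dψ p v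
  have h7 := S.mink_φ_ψ p
  rw [S.ψ_eq, mink_comm, mink_smul_left] at h7
  rw [h5, mink_comm, mink_smul_left] at h6
  have h8 : mink (nullVec (S.gauss p)) (S.φ p) ≠ 0 := by
    intro h9
    rw [h9] at h7
    norm_num at h7
  have h9 : (S.dψ p v).1 = 0 := (mul_eq_zero.1 h6).resolve_right h8
  rw [h5, h9, zero_smul]

/-- The image of the Gauss map is open and the support function is a function of it. -/
theorem IsUniformlyWeaklyHorosphericallyConvex.exists_profile
    (h : S.IsUniformlyWeaklyHorosphericallyConvex) (hinj : Function.Injective S.gauss) :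
    ∃ (Ω : TopologicalSpace.Opens (Sph n)) (ρ : Sph n → ℝ),
      (Ω : Set (Sph n)) = range S.gauss ∧ ContMDiffOn (𝓡 n) 𝓘(ℝ, ℝ) ∞ ρ (Ω : Set (Sph n)) ∧
      (∀ p, ρ (S.gauss p) = S.support p) ∧
      ∃ F : Ω → M, ContMDiff (𝓡 n) (𝓡 n) ∞ F ∧ ∀ x, S.gauss (F x) = x := by
  rcases isEmpty_or_nonempty M with hM | hM
  · have hno : ∀ x, x ∉ (⊥ : TopologicalSpace.Opens (Sph n)) := fun x hx => hx
    exact ⟨⊥, 0, (range_eq_empty S.gauss).symm, fun x hx => absurd hx (hno x), fun p => hM.elim p,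
      fun x => absurd x.2 (hno x), fun x => absurd x.2 (hno x), fun x => absurd x.2 (hno x)⟩
  · obtain ⟨hopen, g, hg, hgs⟩ :=
      exists_smooth_inverse S.smooth_gauss h.mfderiv_gauss_injective hinj
    refine ⟨⟨range S.gauss, hopen⟩, S.support ∘ g, rfl, S.smooth_support.comp_contMDiffOn hgs,
      fun p => by simp [hg], fun x => g x, fun x => ?_, ?_⟩
    · exact ContMDiffAt.comp x (hgs.contMDiffAt (hopen.mem_nhds x.2))
        (contMDiff_opens_val (⟨range S.gauss, hopen⟩ : TopologicalSpace.Opens (Sph n)) x)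
    · rintro ⟨_, p, rfl⟩
      simp [hg]

section Profile

variable {ρ : Sph n → ℝ}

theorem dψ_eq_coneDeriv {p : M} (hρs : ContMDiffAt (𝓡 n) 𝓘(ℝ, ℝ) ∞ ρ (S.gauss p))
    (hρ : ∀ p, ρ (S.gauss p) = S.support p) (v : TangentSpace (𝓡 n) p) :
    S.dψ p v = coneDeriv ρ (S.gauss p) (sphDeriv S.gauss p v) := by
  have h1 : S.ψ = fun q => Real.exp (ρ (S.gauss q)) • nullVec (S.gauss q) := by
    ext1 q
    rw [hρ, S.ψ_eq]
  rw [dψ, h1]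
  exact mfderiv_cone (S.mdifferentiableAt_gauss p) hρs v

/-- A point of hyperbolic space is determined by its products with the light cone map and its
differential. -/
theorem eq_flowMap {X : Mink n} {x : Sph n} (hρs : ContMDiffAt (𝓡 n) 𝓘(ℝ, ℝ) ∞ ρ x)
    (hX : mink X X = -1) (hψ : mink X (Real.exp (ρ x) • nullVec x) = -1)
    (hdψ : ∀ u : Euc n, ⟪(x : Euc n), u⟫ = 0 → mink X (coneDeriv ρ x u) = 0) :
    X = flowMap ρ 0 x := by
  have hE := (Real.exp_pos (ρ x)).ne'
  have hg := inner_sphGrad_self hρs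
  have hg' := hg
  rw [real_inner_comm] at hg'
  have h1 : X.1 = ⟪X.2, (x : Euc n)⟫ + Real.exp (-ρ x) := by
    rw [mink_comm, mink_smul_left, mink_comm] at hψ
    simp only [mink, nullVec, mul_one] at hψ
    rw [Real.exp_neg]
    field_simp
    linarith
  have h2 : ∀ u : Euc n, ⟪(x : Euc n), u⟫ = 0 → ⟪X.2, u⟫ = Real.exp (-ρ x) * ⟪sphGrad ρ x, u⟫ := by
    intro u hu
    have h3 := hdψ u hu
    rw [coneDeriv, mink_comm, mink_smul_left, mul_eq_zero, or_iff_right hE, mink_comm] at h3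
    simp only [mink, inner_add_right, real_inner_smul_right] at h3
    rw [h1] at h3
    linarith
  -- The products with `coneDeriv` fix the tangential part of `X.2`: the residual `z` is tangent and
  -- orthogonal to itself. The radial part then follows from the time coordinate, which `⟨X, X⟩ =
  -- -1` determines.
  have h3 : X.2 = ⟪X.2, (x : Euc n)⟫ • (x : Euc n) + Real.exp (-ρ x) • sphGrad ρ x := by
    set z := X.2 - ⟪X.2, (x : Euc n)⟫ • (x : Euc n) - Real.exp (-ρ x) • sphGrad ρ x with hz
    have hzx : ⟪(x : Euc n), z⟫ = 0 := by
      rw [hz]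
      simp only [inner_sub_right, real_inner_smul_right, inner_self_sph, hg',
        real_inner_comm X.2 (x : Euc n)]
      ring
    have hzz : ⟪z, z⟫ = 0 := by
      nth_rewrite 1 [hz]
      simp only [inner_sub_left, real_inner_smul_left, hzx, h2 z hzx]
      ring
    rw [inner_self_eq_zero, hz, sub_sub, sub_eq_zero] at hzz
    exact hzz
  have h4 : ⟪X.2, X.2⟫ = ⟪X.2, (x : Euc n)⟫ ^ 2 + Real.exp (-ρ x) ^ 2 * ‖sphGrad ρ x‖ ^ 2 := by
    nth_rewrite 1 [h3]
    rw [inner_add_left, real_inner_smul_left, real_inner_smul_left, real_inner_comm X.2 (x : Euc n),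
      real_inner_comm X.2 (sphGrad ρ x), h2 _ hg', real_inner_self_eq_norm_sq]
    ring
  have h5 : X.1 = Real.exp (ρ x) / 2 * (1 + Real.exp (-2 * ρ x) * (1 + ‖sphGrad ρ x‖ ^ 2)) := by
    have h6 : ⟪X.2, (x : Euc n)⟫ = X.1 - Real.exp (-ρ x) := by linarith
    rw [mink, h4, h6] at hX
    rw [show -2 * ρ x = -(ρ x) + -(ρ x) by ring, Real.exp_add]
    rw [Real.exp_neg] at hX ⊢
    field_simp at hX ⊢
    linarith
  rw [flowMap_zero, ← h5]
  ext1
  · rfl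
  · rw [h3]
    have h6 : ⟪X.2, (x : Euc n)⟫ = X.1 - Real.exp (-ρ x) := by linarith
    rw [h6]
    module

theorem φ_eq_flowMap {p : M} (hρs : ContMDiffAt (𝓡 n) 𝓘(ℝ, ℝ) ∞ ρ (S.gauss p))
    (hρ : ∀ p, ρ (S.gauss p) = S.support p)
    (hinj : Function.Injective (mfderiv (𝓡 n) (𝓡 n) S.gauss p)) :
    S.φ p = flowMap ρ 0 (S.gauss p) := by
  refine eq_flowMap hρs (S.mem_hyp p).1 ?_ fun u hu => ?_
  · rw [hρ, ← S.ψ_eq]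
    exact S.mink_φ_ψ p
  · obtain ⟨v, rfl⟩ := exists_sphDeriv_eq (S.mdifferentiableAt_gauss p) hinj hu
    have h1 := S.mink_φ_dψ p v
    rwa [dψ_eq_coneDeriv hρs hρ] at h1

theorem coneDeriv_smul (ρ : Sph n → ℝ) (x : Sph n) (r : ℝ) (u : Euc n) :
    coneDeriv ρ x (r • u) = r • coneDeriv ρ x u := by
  simp only [coneDeriv, real_inner_smul_right]
  ext1
  · simp; ring
  · simp only [Prod.smul_snd]; module

/-- A lower bound on the principal curvatures bounds the operator `halfSubP`. -/
theorem norm_halfSubP_le {κ₀ : ℝ} (hκ₀ : -1 < κ₀)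
    {p : M} (hκ : ∀ κ, S.IsPrincipalCurvature p κ → κ₀ ≤ κ)
    (hρs : ContMDiffAt (𝓡 n) 𝓘(ℝ, ℝ) ∞ ρ (S.gauss p))
    (hρ : ∀ p, ρ (S.gauss p) = S.support p)
    (hinj : Function.Injective (mfderiv (𝓡 n) (𝓡 n) S.gauss p))
    (hdφ : ∀ v, S.dφ p v =
      coneDeriv ρ (S.gauss p) (halfSubP ρ (S.gauss p) (sphDeriv S.gauss p v)))
    {u : Euc n} (hu : ⟪(S.gauss p : Euc n), u⟫ = 0) :
    ‖halfSubP ρ (S.gauss p) u‖ ≤ (1 + κ₀)⁻¹ * ‖u‖ := by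
  set x := S.gauss p with hx
  let W : Submodule ℝ (Euc n) := (ℝ ∙ (x : Euc n))ᗮ
  have hW : ∀ w ∈ W, ⟪(x : Euc n), w⟫ = 0 := fun w hw =>
    Submodule.mem_orthogonal_singleton_iff_inner_right.1 hw
  let T : W →ₗ[ℝ] W := (halfSubP ρ x : Euc n →ₗ[ℝ] Euc n).restrict fun w hw =>
    Submodule.mem_orthogonal_singleton_iff_inner_right.2 (inner_self_halfSubP hρs (hW w hw))
  have hT : T.IsSymmetric := by
    intro v w
    change ⟪halfSubP ρ x v, (w : Euc n)⟫ = ⟪(v : Euc n), halfSubP ρ x w⟫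
    rw [real_inner_comm _ (v : Euc n), inner_halfSubP hρs _ (hW w w.2),
      inner_halfSubP hρs _ (hW v v.2), tensorP_symm hρs, real_inner_comm]
  have h1 : 0 < 1 + κ₀ := by linarith
  refine norm_le_of_eigenvalues_le hT (inv_nonneg.2 h1.le) ?_
    (⟨u, Submodule.mem_orthogonal_singleton_iff_inner_right.2 hu⟩ : W)
  rintro s ⟨w, hw⟩ hw0 hTw
  have hw0' : w ≠ 0 := fun h => hw0 (Subtype.ext h)
  have hsw : halfSubP ρ x w = s • w := congrArg Subtype.val hTw
  obtain ⟨v, hv⟩ := exists_sphDeriv_eq (S.mdifferentiableAt_gauss p) hinj (hW w hw)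
  have hv0 : v ≠ 0 := by
    rintro rfl
    exact hw0' (hv.symm.trans (map_zero _))
  have h2 : S.dφ p v = s • coneDeriv ρ x w := by
    rw [hdφ, ← coneDeriv_smul, ← hsw]
    exact congrArg (fun u => coneDeriv ρ x (halfSubP ρ x u)) hv
  have h3 : S.dψ p v = coneDeriv ρ x w := by
    rw [dψ_eq_coneDeriv hρs hρ]
    exact congrArg (coneDeriv ρ x) hv
  -- A zero eigenvalue would give `dφ v = 0` with `v ≠ 0`, against `φ` being an immersion. Then `s⁻¹
  -- - 1` is a principal curvature, and `κ₀ ≤ s⁻¹ - 1` also forces `s > 0`.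
  have hs0 : s ≠ 0 := by
    rintro rfl
    rw [zero_smul] at h2
    exact hv0 (S.immersion p (h2.trans (map_zero (S.dφ p)).symm))
  have h4 : S.dη p v = -((s⁻¹ - 1) • S.dφ p v) := by
    have h5 : S.dη p v = S.dφ p v - S.dψ p v := by
      rw [dψ_eq]
      exact (sub_sub_cancel _ _).symm
    rw [h5, h3, h2, smul_smul, sub_mul, inv_mul_cancel₀ hs0]
    module
  have h5 := hκ (s⁻¹ - 1) ⟨v, hv0, h4⟩
  have h6 : 1 + κ₀ ≤ s⁻¹ := by linarith
  have h7 : 0 < s := inv_pos.1 (h1.trans_le h6)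
  rw [abs_of_pos h7]
  exact (le_inv_comm₀ h1 h7).1 h6

end Profile

theorem IsComplete.exists_isRealizable (hcomp : S.IsComplete)
    (hconv : S.IsUniformlyWeaklyHorosphericallyConvex) (hinj : Function.Injective S.gauss) :
    ∃ (Ω : TopologicalSpace.Opens (Sph n)) (ρ : Sph n → ℝ),
      (Ω : Set (Sph n)) = range S.gauss ∧
      (ConnectedSpace M → IsConnected (Ω : Set (Sph n))) ∧
      (∀ p, ρ (S.gauss p) = S.support p) ∧
      (∀ p (v : TangentSpace (𝓡 n) p), S.horosphericalForm p v =
        Real.exp (2 * ρ (S.gauss p)) * roundLength S.gauss p v ^ 2) ∧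
      IsRealizable Ω ρ ∧ S.boundaryAtInfinity = frontier (Ω : Set (Sph n)) := by
  obtain ⟨Ω, ρ, hΩ, hsm, hρ, F, hF, hGF⟩ := hconv.exists_profile hinj
  have hd := hconv.mfderiv_gauss_injective
  have hmem : ∀ p, S.gauss p ∈ Ω := fun p => by
    rw [← SetLike.mem_coe, hΩ]; exact mem_range_self p
  have hρx : ∀ x ∈ Ω, ContMDiffAt (𝓡 n) 𝓘(ℝ, ℝ) ∞ ρ x := fun x hx =>
    hsm.contMDiffAt (Ω.isOpen.mem_nhds hx)
  have hρs : ∀ p, ContMDiffAt (𝓡 n) 𝓘(ℝ, ℝ) ∞ ρ (S.gauss p) := fun p => hρx _ (hmem p)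
  have hφ : ∀ p, S.φ p = flowMap ρ 0 (S.gauss p) := fun p => φ_eq_flowMap (hρs p) hρ (hd p)
  have hdφ : ∀ p v, S.dφ p v =
      coneDeriv ρ (S.gauss p) (halfSubP ρ (S.gauss p) (sphDeriv S.gauss p v)) := by
    intro p v
    have h1 : S.φ = fun q => flowMap ρ 0 (S.gauss q) := funext hφ
    rw [dφ, h1]
    exact mfderiv_flowMap (S.mdifferentiableAt_gauss p) (hρs p) v
  obtain ⟨κ₀, hκ₀, hκ⟩ := hconv
  have hκ1 : 0 < 1 + κ₀ := by linarith
  have hbound : ∀ x ∈ Ω, ∀ u : Euc n, ⟪(x : Euc n), u⟫ = 0 →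
      ‖halfSubP ρ x u‖ ≤ (1 + κ₀)⁻¹ * ‖u‖ := by
    intro x hx u hu
    obtain ⟨p, rfl⟩ : x ∈ range S.gauss := hΩ ▸ hx
    exact norm_halfSubP_le hκ₀ (hκ p) (hρs p) hρ (hd p) (hdφ p) hu
  have hreal : IsRealizable Ω ρ := by
    -- The constant bounds `P = exp (2ρ) (1/2 - Q)` through the norm of `Q`. Completeness is pulled
    -- back along `F`, the inverse of the Gauss map, which lengthens vectors by at most the same
    -- bound `(1 + κ₀)⁻¹` on `Q`.
    refine ⟨hsm, ?_, 1 / 2 + (1 + κ₀)⁻¹, fun x hx u v hu hv => ?_⟩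
    · refine hcomp.of_map (F := F) (g := fun p => ⟨S.gauss p, hmem p⟩) S.inducedNorm_smul
        (hF.of_le (by simp)) (S.smooth_gauss.continuous.subtype_mk _)
        (fun x => Subtype.ext (hGF x)) (inv_pos.2 hκ1) fun x v => ?_
      have h1 : sphDeriv S.gauss (F x) (mfderiv (𝓡 n) (𝓡 n) F x v) =
          sphDeriv (Subtype.val : Ω → Sph n) x v := by
        have h2 : (Subtype.val : Ω → Sph n) = fun y => S.gauss (F y) := funext fun y => (hGF y).symm
        have h3 : MDifferentiableAt (𝓡 n) 𝓘(ℝ, Euc n) (fun q => (S.gauss q : Euc n)) (F x) :=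
          (contMDiff_sphere_val.comp S.smooth_gauss (F x)).mdifferentiableAt (by simp)
        have h4 := mfderiv_comp x h3 ((hF x).mdifferentiableAt (by simp))
        have h5 : sphDeriv (fun y => S.gauss (F y)) x v = _ := congrArg (fun l => l v) h4
        rw [h2, h5]
        rfl
      have hu := inner_sphDeriv (S.mdifferentiableAt_gauss (F x)) (mfderiv (𝓡 n) (𝓡 n) F x v)
      have h2 := inner_self_halfSubP (hρs (F x)) hu
      have h3 : S.inducedNorm (F x) (mfderiv (𝓡 n) (𝓡 n) F x v) = Real.exp (ρ (S.gauss (F x))) *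
          ‖halfSubP ρ (S.gauss (F x))
            (sphDeriv S.gauss (F x) (mfderiv (𝓡 n) (𝓡 n) F x v))‖ := by
        change √(mink (S.dφ (F x) _) (S.dφ (F x) _)) = _
        rw [hdφ, mink_coneDeriv h2 h2, real_inner_self_eq_norm_sq,
          Real.sqrt_eq_iff_mul_self_eq (by positivity) (by positivity), two_mul, Real.exp_add]
        ring
      have h4 := hbound _ (hmem (F x)) _ hu
      rw [h3]
      refine (mul_le_mul_of_nonneg_left h4 (Real.exp_pos _).le).trans (le_of_eq ?_)
      rw [h1, hGF]
      change _ = (1 + κ₀)⁻¹ * (Real.exp (ρ x) * ‖sphDeriv (Subtype.val : Ω → Sph n) x v‖)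
      ring
    · have h1 := inner_halfSubP (hρx x hx) u hv
      have h2 : tensorP ρ x u v =
          Real.exp (2 * ρ x) * (1 / 2 * ⟪u, v⟫ - ⟪halfSubP ρ x u, v⟫) := by
        rw [h1, show -2 * ρ x = -(2 * ρ x) by ring, Real.exp_neg]
        field_simp
        ring
      have h3 := abs_real_inner_le_norm u v
      have h4 := (abs_real_inner_le_norm (halfSubP ρ x u) v).trans
        (mul_le_mul_of_nonneg_right (hbound x hx u hu) (norm_nonneg v))
      have h5 : |1 / 2 * ⟪u, v⟫ - ⟪halfSubP ρ x u, v⟫| ≤ (1 / 2 + (1 + κ₀)⁻¹) * ‖u‖ * ‖v‖ := by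
        rw [abs_le] at h3 h4 ⊢
        constructor <;> linarith
      rw [h2, abs_mul, abs_of_pos (Real.exp_pos _)]
      calc _ ≤ Real.exp (2 * ρ x) * ((1 / 2 + (1 + κ₀)⁻¹) * ‖u‖ * ‖v‖) := by gcongr
        _ = _ := by ring
  refine ⟨Ω, ρ, hΩ, fun _ => ?_, hρ, fun p v => ?_, hreal, ?_⟩
  · rw [hΩ]
    exact isConnected_range S.smooth_gauss.continuous
  · have hu := inner_sphDeriv (S.mdifferentiableAt_gauss p) v
    change mink (S.dψ p v) (S.dψ p v) = _
    rw [dψ_eq_coneDeriv (hρs p) hρ, mink_coneDeriv hu hu, real_inner_self_eq_norm_sq,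
      roundLength_eq]
  · rw [← hreal.boundary_flowMap]
    have h1 : (range fun p => toBall (S.φ p)) = range fun x : Ω => toBall (flowMap ρ 0 x) := by
      ext X
      constructor
      · rintro ⟨p, rfl⟩
        exact ⟨⟨S.gauss p, hmem p⟩, by simp only [hφ]⟩
      · rintro ⟨x, rfl⟩
        exact ⟨F x, by simp only [hφ, hGF]⟩
    rw [boundaryAtInfinity, h1]

end OrientedHypersurface

end HoroConvex

end

theorem theorem1p2 (n : ℕ) (hn : 2 ≤ n) :
    (∀ (M : Type*) [TopologicalSpace M] [T2Space M] [SecondCountableTopology M]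
      [ChartedSpace (EuclideanSpace ℝ (Fin n)) M] [IsManifold (𝓡 n) ∞ M]
      (S : HoroConvex.OrientedHypersurface n M),
      S.IsComplete → S.IsUniformlyWeaklyHorosphericallyConvex → Function.Injective S.gauss →
      ∃ (Ω : TopologicalSpace.Opens (HoroConvex.Sph n)) (ρ : HoroConvex.Sph n → ℝ),
        (Ω : Set (HoroConvex.Sph n)) = Set.range S.gauss ∧
        (ConnectedSpace M → IsConnected (Ω : Set (HoroConvex.Sph n))) ∧
        (∀ p, ρ (S.gauss p) = S.support p) ∧
        (∀ p (v : TangentSpace (𝓡 n) p), S.horosphericalForm p v =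
          Real.exp (2 * ρ (S.gauss p)) * HoroConvex.roundLength S.gauss p v ^ 2) ∧
        HoroConvex.IsRealizable Ω ρ ∧
        S.boundaryAtInfinity = frontier (Ω : Set (HoroConvex.Sph n))) ∧
    (∀ (Ω : TopologicalSpace.Opens (HoroConvex.Sph n)) (ρ : HoroConvex.Sph n → ℝ),
      HoroConvex.IsRealizable Ω ρ →
      ∃ t₀ : ℝ, ∀ t ≥ t₀, ∃ S : HoroConvex.OrientedHypersurface n Ω,
        (∀ x : Ω, S.φ x = HoroConvex.flowMap ρ t x) ∧
        (∀ x : Ω, S.gauss x = x ∧ S.support x = ρ x + t) ∧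
        S.IsAdmissible ∧
        S.boundaryAtInfinity = frontier (Ω : Set (HoroConvex.Sph n))) := by
  exact ⟨fun _ _ _ _ _ _ _ hcomp hconv hinj => hcomp.exists_isRealizable hconv hinj,
    fun _ _ h => h.exists_forall_hypersurface⟩
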